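/- For a finite simple graph $G$ let $n$ be its number of vertices, $\bar d$ its average degree, $\Delta$ its maximum degree and $\tau(G)$ the minimum size of a vertex cover. For every $\varepsilon>0$ there is a randomized algorithm (a program for a unit-cost random access machine with addition, truncated subtraction and fair coin flips, the input being $n$ and the adjacency matrix) such that the following hold. 1. On every graph with $0<\Delta\le n/2$ the algorithm always halts and returns a vertex cover, and with probability at least $1-1/n$ the vertex cover it returns has size at most $$\left(\frac{2}{1+\frac{\bar d}{2\Delta}}+\varepsilon\right)\tau(G).$$ 2. For every $c>0$ there are $K,N\in\mathbb N$ such that for every $\psi:\mathbb N\to(0,\infty)$ and every graph with $n\ge N$ vertices, $\Delta\le n/2$ and $\Delta\ge c\,n/\psi(n)$, the worst-case running time (over all coin flips) is at most $n^{K}\,2^{K\psi(n)\ln\ln\ln n}$. That is, on graphs with $\Delta\le n/2$ and $\Delta=\Omega(n/\psi(n))$ the running time is $n^{O(1)}2^{O(\psi(n)\log\log\log n)}$. 3. If $\psi:\mathbb N\to(0,\infty)$ satisfies $\psi(n)=O(\log n/\log\log\log n)$ and $c>0$, then on the graphs with $n\ge 1$, $\Delta\le n/2$ and $\Delta\ge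 c\,n/\psi(n)$ the worst-case running time is bounded by a polynomial in $n$. -/

import Mathlib

/-! ## A randomized random access machine with a step count

Programs of a unit-cost RAM (constants, addition, truncated subtraction, indirect addressing, tests
against zero, fair coin flips; no multiplication), written in structured form. A program refers to
finitely many registers and finitely many arrays. Without multiplication a number computed in `T`
steps has `O(T)` bits, so that unit-cost time is polynomially related to Turing machine time. -/

namespace RandRAM

/-- The memory: `reg x` is the content of register `x`, and `arr a i` is cell `i` of array `a`. -/
structure Mem where
  reg : ℕ → ℕ
  arr : ℕ → ℕ → ℕ

/-- Write `v` into register `x`. -/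
def Mem.setReg (σ : Mem) (x v : ℕ) : Mem :=
  { σ with reg := Function.update σ.reg x v }

/-- Write `v` into cell `i` of array `a`. -/
def Mem.setArr (σ : Mem) (a i v : ℕ) : Mem :=
  { σ with arr := Function.update σ.arr a (Function.update (σ.arr a) i v) }

/-- Programs. -/
inductive Prog where
  /-- do nothing -/
  | skip : Prog
  /-- `reg x := k` for a constant `k` of the program -/
  | const (x k : ℕ) : Prog
  /-- `reg x := reg y + reg z` -/
  | add (x y z : ℕ) : Prog
  /-- `reg x := reg y - reg z`, truncated at `0` -/
  | sub (x y z : ℕ) : Prog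
  /-- `reg x := arr a (reg y)` -/
  | load (x a y : ℕ) : Prog
  /-- `arr a (reg x) := reg y` -/
  | store (a x y : ℕ) : Prog
  /-- `reg x := ` a fresh fair random bit -/
  | flip (x : ℕ) : Prog
  /-- run `p`, then `q` -/
  | seq (p q : Prog) : Prog
  /-- run `p` if `reg x ≠ 0`, otherwise `q` -/
  | ite (x : ℕ) (p q : Prog) : Prog
  /-- while `reg x ≠ 0`, run `p` -/
  | while (x : ℕ) (p : Prog) : Prog

/-- A configuration: the stack of programs that remain to be run, and the memory. It is halted when
the stack is empty. -/
abbrev Config : Type := List Prog × Mem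

/-- One step of the machine. Each elementary instruction, each test of a branch or loop, and each
unfolding of a sequential composition is one step; halted configurations do not change. -/
noncomputable def step : Config → PMF Config
  | ([], σ) => PMF.pure ([], σ)
  | (.skip :: k, σ) => PMF.pure (k, σ)
  | (.const x v :: k, σ) => PMF.pure (k, σ.setReg x v)
  | (.add x y z :: k, σ) => PMF.pure (k, σ.setReg x (σ.reg y + σ.reg z))
  | (.sub x y z :: k, σ) => PMF.pure (k, σ.setReg x (σ.reg y - σ.reg z))
  | (.load x a y :: k, σ) => PMF.pure (k, σ.setReg x (σ.arr a (σ.reg y)))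
  | (.store a x y :: k, σ) => PMF.pure (k, σ.setArr a (σ.reg x) (σ.reg y))
  | (.flip x :: k, σ) =>
      (PMF.uniformOfFintype Bool).bind fun b => PMF.pure (k, σ.setReg x b.toNat)
  | (.seq p q :: k, σ) => PMF.pure (p :: q :: k, σ)
  | (.ite x p q :: k, σ) => PMF.pure ((if σ.reg x ≠ 0 then p else q) :: k, σ)
  | (.while x p :: k, σ) =>
      PMF.pure (if σ.reg x ≠ 0 then p :: Prog.while x p :: k else k, σ)

/-- The distribution of the configuration after `T` steps. -/
noncomputable def runFor : ℕ → Config → PMF Config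
  | 0, κ => PMF.pure κ
  | T + 1, κ => (step κ).bind (runFor T)

/-- Worst-case time: started in `σ`, the program `P` has halted after at most `T` steps whatever
the outcomes of the coin flips. -/
def HaltsIn (P : Prog) (σ : Mem) (T : ℕ) : Prop :=
  ∀ κ ∈ (runFor T ([P], σ)).support, κ.1 = []

/-- The distribution of the memory after `T` steps of `P` from `σ` (the final memory, if
`HaltsIn P σ T`). -/
noncomputable def memAfter (P : Prog) (σ : Mem) (T : ℕ) : PMF Mem :=
  (runFor T ([P], σ)).map Prod.snd

/-- The input memory for a graph on `n` vertices: `n` is in register `0`, the adjacency matrix is in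
array `0` (row by row, entry `(u, v)` in cell `u * n + v`), and everything else is `0`. -/
def graphInput {n : ℕ} (G : SimpleGraph (Fin n)) [DecidableRel G.Adj] : Mem where
  reg x := if x = 0 then n else 0
  arr a i := if a = 0 ∧ ∃ u v : Fin n, G.Adj u v ∧ i = (u : ℕ) * n + (v : ℕ) then 1 else 0

/-- The vertex set that a final memory stands for: `v` belongs to it if cell `v` of array `1` is
not `0`. -/
def outputSet (n : ℕ) (σ : Mem) : Finset (Fin n) :=
  Finset.univ.filter fun v => σ.arr 1 (v : ℕ) ≠ 0

end RandRAM

/-- The average degree (`0` if there are no vertices). -/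
noncomputable def SimpleGraph.avgDegree {n : ℕ} (G : SimpleGraph (Fin n)) [DecidableRel G.Adj] : ℝ :=
  (∑ v, (G.degree v : ℝ)) / n

/-- The randomized algorithm `P`, run on the graph `G`, always halts (within a number of steps that
does not depend on the coin flips), always returns a vertex cover, and with probability at least `q`
returns one that has at most `ρ` times the minimum size. -/
def RandRAM.Prog.ApproximatesVC {n : ℕ} (P : RandRAM.Prog) (G : SimpleGraph (Fin n))
    [DecidableRel G.Adj] (ρ q : ℝ) : Prop :=
  ∃ T : ℕ, RandRAM.HaltsIn P (RandRAM.graphInput G) T ∧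
    (∀ σ ∈ (RandRAM.memAfter P (RandRAM.graphInput G) T).support,
      G.IsVertexCover (RandRAM.outputSet n σ : Set (Fin n))) ∧
    q ≤ ((RandRAM.memAfter P (RandRAM.graphInput G) T).toOuterMeasure
      {σ | ((RandRAM.outputSet n σ).card : ℝ) ≤ ρ * (G.vertexCoverNum.toNat : ℝ)}).toReal

/-! ## The algorithm and why it works

Let `γ = d̄ / (2 Δ)`, fix a minimum vertex cover `O`, and let `τ = |O|`. If `W ⊆ O` is known, then `W`
together with the ends of a maximal matching of `G - W` is a vertex cover `C` with at most
`2 τ - |W|` vertices. As also `|C| ≤ n`, weighting the two bounds shows `|C| ≤ 2 τ / (1 + γ)` if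
`|W| ≥ γ n`. It does no harm to the ratio if a small fraction of `W` is not in `O` and if `W` is a
little smaller (`card_le_ratio`). Since `γ n` is the number of edges over `Δ`, every `W` that covers
almost all edges is large enough (`mul_sum_degree_le`).

To find `W`, start from `∅` and look at the heavy vertices: those with at least `Δ / k` neighbours
outside `W`. If fewer than `n / k` of them are outside `W`, then `W` covers almost all edges.
Otherwise, either a fraction of at least `1 / k` of these vertices is not in `O`, and then a random
vertex `u` is one of them with probability at least `1 / (4 k ^ 2)`; all its neighbours are in `O`
and are added to `W`. Or almost all of them are in `O`, and then all heavy vertices are added to `W`.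
A random number decides which of the two is tried (`exists_good_choices`). In both cases `W` grows by
at least `Δ / k`, so that `R = O(n / Δ)` rounds are enough, and a trial succeeds with probability
`2 ^ (- O(n / Δ))`. With `n * 2 ^ O(n / Δ)` independent trials the failure probability is at most
`exp (-n) ≤ 1 / n` (`trials_fail_le`). For `Δ ≥ c n / ψ` the time is `n ^ O(1) * 2 ^ O(ψ)`
(`exists_mainTime_le`), which is even better than the bound with the factor `log log log n`.

The program is verified in a program logic with two judgements: `Tri` (whatever the coin flips, the
program ends in time in a memory with a given property) and `Qnt` (moreover, it reaches a goal with
at least a given probability). Programs keep their variables in registers with fixed numbers, inner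
subroutines using higher numbers, so that a frame condition "the registers below `b` are unchanged"
describes what a subroutine may touch. -/

namespace RandRAM

/-! ### Hitting probabilities -/

open scoped ENNReal

@[simp] theorem Mem.setReg_reg (σ : Mem) (x v y : ℕ) :
    (σ.setReg x v).reg y = if y = x then v else σ.reg y := by
  simp [Mem.setReg, Function.update_apply]

@[simp] theorem Mem.setReg_arr (σ : Mem) (x v : ℕ) : (σ.setReg x v).arr = σ.arr := rfl

@[simp] theorem Mem.setArr_reg (σ : Mem) (a i v : ℕ) : (σ.setArr a i v).reg = σ.reg := rfl

@[simp] theorem Mem.setArr_arr (σ : Mem) (a i v b j : ℕ) :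
    (σ.setArr a i v).arr b j = if b = a ∧ j = i then v else σ.arr b j := by
  by_cases hb : b = a
  · subst hb
    simp [Mem.setArr, Function.update_apply]
  · simp [Mem.setArr, hb]

/-- The probability that a run from `κ` has halted after `T` steps with a memory in `S`. -/
noncomputable def hitProb (S : Set Mem) (T : ℕ) (κ : Config) : ℝ :=
  ((runFor T κ).toOuterMeasure {κ' | κ'.1 = [] ∧ κ'.2 ∈ S}).toReal

theorem toOuterMeasure_ne_top {α : Type*} (p : PMF α) (s : Set α) : p.toOuterMeasure s ≠ ∞ :=
  ne_top_of_le_ne_top ENNReal.one_ne_top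
    ((p.toOuterMeasure.mono (Set.subset_univ s)).trans
      ((p.toOuterMeasure_apply_eq_one_iff _).2 (Set.subset_univ _)).le)

theorem hitProb_zero {S : Set Mem} {σ : Mem} (h : σ ∈ S) : hitProb S 0 ([], σ) = 1 := by
  simp [hitProb, runFor, PMF.toOuterMeasure_pure_apply, h]

theorem hitProb_nonneg (S : Set Mem) (T : ℕ) (κ : Config) : 0 ≤ hitProb S T κ :=
  ENNReal.toReal_nonneg

theorem hitProb_pure {S : Set Mem} {T : ℕ} {κ κ' : Config} (h : step κ = PMF.pure κ') :
    hitProb S (T + 1) κ = hitProb S T κ' := by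
  simp [hitProb, runFor, h, PMF.pure_bind]

theorem hitProb_flip (S : Set Mem) (T x : ℕ) (k : List Prog) (σ : Mem) :
    hitProb S (T + 1) (.flip x :: k, σ)
      = (hitProb S T (k, σ.setReg x 0) + hitProb S T (k, σ.setReg x 1)) / 2 := by
  have h : (runFor (T + 1) (.flip x :: k, σ)) =
      (PMF.uniformOfFintype Bool).bind fun b => runFor T (k, σ.setReg x b.toNat) := by
    simp [runFor, step, PMF.bind_bind, PMF.pure_bind]
  simp only [hitProb, h, PMF.toOuterMeasure_bind_apply, tsum_fintype, Fintype.sum_bool,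
    PMF.uniformOfFintype_apply, Fintype.card_bool, Bool.toNat_true, Bool.toNat_false]
  rw [ENNReal.toReal_add (ENNReal.mul_ne_top (by simp) (toOuterMeasure_ne_top _ _))
    (ENNReal.mul_ne_top (by simp) (toOuterMeasure_ne_top _ _)), ENNReal.toReal_mul,
    ENNReal.toReal_mul]
  simp
  ring

theorem toOuterMeasure_runFor_le_succ (S : Set Mem) (T : ℕ) (κ : Config) :
    (runFor T κ).toOuterMeasure {κ' | κ'.1 = [] ∧ κ'.2 ∈ S}
      ≤ (runFor (T + 1) κ).toOuterMeasure {κ' | κ'.1 = [] ∧ κ'.2 ∈ S} := by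
  induction T generalizing κ with
  | zero =>
    obtain ⟨l, σ⟩ := κ
    cases l with
    | nil => simp [runFor, step]
    | cons p k => simp [runFor, PMF.toOuterMeasure_pure_apply]
  | succ T ih =>
    rw [runFor, runFor, PMF.toOuterMeasure_bind_apply, PMF.toOuterMeasure_bind_apply]
    exact ENNReal.tsum_le_tsum fun κ' => mul_le_mul_right (ih κ') _

theorem hitProb_mono (S : Set Mem) (κ : Config) : Monotone fun T => hitProb S T κ :=
  monotone_nat_of_le_succ fun T =>
    ENNReal.toReal_mono (toOuterMeasure_ne_top _ _) (toOuterMeasure_runFor_le_succ S T κ)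

theorem support_of_hitProb_eq_one {S : Set Mem} {T : ℕ} {κ κ' : Config}
    (h : 1 ≤ hitProb S T κ) (hκ : κ' ∈ (runFor T κ).support) : κ'.1 = [] ∧ κ'.2 ∈ S := by
  have h1 : (runFor T κ).toOuterMeasure {κ' | κ'.1 = [] ∧ κ'.2 ∈ S} = 1 := by
    refine le_antisymm ?_ ?_
    · exact ((PMF.toOuterMeasure _).mono (Set.subset_univ _)).trans
        ((PMF.toOuterMeasure_apply_eq_one_iff _ _).2 (Set.subset_univ _)).le
    · rw [← ENNReal.ofReal_one]
      exact (ENNReal.ofReal_le_iff_le_toReal (toOuterMeasure_ne_top _ _)).2 h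
  exact ((PMF.toOuterMeasure_apply_eq_one_iff _ _).1 h1) hκ

theorem haltsIn_of_hitProb {P : Prog} {σ : Mem} {T : ℕ} (h : 1 ≤ hitProb Set.univ T ([P], σ)) :
    HaltsIn P σ T :=
  fun _ hκ => (support_of_hitProb_eq_one h hκ).1

theorem mem_of_hitProb {P : Prog} {σ σ' : Mem} {S : Set Mem} {T : ℕ}
    (h : 1 ≤ hitProb S T ([P], σ)) (hσ : σ' ∈ (memAfter P σ T).support) : σ' ∈ S := by
  obtain ⟨κ, hκ, rfl⟩ := (PMF.mem_support_map_iff _ _ _).1 hσ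
  exact (support_of_hitProb_eq_one h hκ).2

theorem hitProb_le_memAfter (P : Prog) (σ : Mem) (S : Set Mem) (T : ℕ) :
    hitProb S T ([P], σ) ≤ ((memAfter P σ T).toOuterMeasure S).toReal := by
  refine ENNReal.toReal_mono (toOuterMeasure_ne_top _ _) ?_
  rw [memAfter, PMF.toOuterMeasure_map_apply]
  exact (PMF.toOuterMeasure _).mono fun κ hκ => hκ.2

/-! ### Program logic -/

/-- Total correctness with a time bound: from `σ`, whatever the coin flips, `P` ends after at most
`T` steps in a memory satisfying `Q`. It is phrased through continuations: a bound on `hitProb` that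
holds for every final memory in `Q` (with any stack `k` left to run) holds before `P`. -/
def Tri (P : Prog) (σ : Mem) (T : ℕ) (Q : Mem → Prop) : Prop :=
  ∀ (k : List Prog) (S : Set Mem) (T' : ℕ) (a : ℝ),
    (∀ σ', Q σ' → a ≤ hitProb S T' (k, σ')) → a ≤ hitProb S (T + T') (P :: k, σ)

/-- The quantitative version of `Tri`: the final memory always satisfies `Q`, and it satisfies `G`
with probability at least `p`. -/
def Qnt (P : Prog) (σ : Mem) (T : ℕ) (p : ℝ) (Q G : Mem → Prop) : Prop :=
  ∀ (k : List Prog) (S : Set Mem) (T' : ℕ) (a b : ℝ), a ≤ b →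
    (∀ σ', Q σ' → a ≤ hitProb S T' (k, σ')) →
    (∀ σ', Q σ' → G σ' → b ≤ hitProb S T' (k, σ')) →
    a + p * (b - a) ≤ hitProb S (T + T') (P :: k, σ)

section Rules

variable {P P' : Prog} {σ : Mem} {T T₁ T₂ : ℕ} {Q Q' G G' : Mem → Prop} {p q : ℝ}

theorem Tri.weaken (h : Tri P σ T Q) (hT : T ≤ T₁) (hQ : ∀ σ', Q σ' → Q' σ') :
    Tri P σ T₁ Q' := fun k S T' a ha =>
  (h k S T' a fun σ' hσ' => ha σ' (hQ σ' hσ')).trans (hitProb_mono S _ (by omega))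

theorem Qnt.weaken (h : Qnt P σ T p Q G) (hT : T ≤ T₁) (hp : q ≤ p) (hQ : ∀ σ', Q σ' → Q' σ')
    (hG : ∀ σ', Q σ' → G σ' → G' σ') : Qnt P σ T₁ q Q' G' := fun k S T' a b hab ha hb => by
  have h1 := h k S T' a b hab (fun σ' h' => ha σ' (hQ σ' h'))
    (fun σ' h' hg => hb σ' (hQ σ' h') (hG σ' h' hg))
  have h2 : q * (b - a) ≤ p * (b - a) := mul_le_mul_of_nonneg_right hp (by linarith)
  have h3 := hitProb_mono S (P :: k, σ) (show T + T' ≤ T₁ + T' by omega)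
  simp only at h3
  linarith

theorem Tri.of_step {σ₁ : Mem} (h : ∀ k, step (P :: k, σ) = PMF.pure (k, σ₁)) (hQ : Q σ₁) :
    Tri P σ 1 Q := fun k S T' a ha => by
  rw [Nat.add_comm, hitProb_pure (h k)]
  exact ha _ hQ

theorem Tri.skip (h : Q σ) : Tri .skip σ 1 Q := .of_step (fun _ => rfl) h

theorem Tri.add {x y z : ℕ} (h : Q (σ.setReg x (σ.reg y + σ.reg z))) : Tri (.add x y z) σ 1 Q :=
  .of_step (fun _ => rfl) h

theorem Tri.sub {x y z : ℕ} (h : Q (σ.setReg x (σ.reg y - σ.reg z))) : Tri (.sub x y z) σ 1 Q :=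
  .of_step (fun _ => rfl) h

theorem Tri.load {x a y : ℕ} (h : Q (σ.setReg x (σ.arr a (σ.reg y)))) : Tri (.load x a y) σ 1 Q :=
  .of_step (fun _ => rfl) h

theorem Tri.store {a x y : ℕ} (h : Q (σ.setArr a (σ.reg x) (σ.reg y))) :
    Tri (.store a x y) σ 1 Q := .of_step (fun _ => rfl) h

theorem Tri.seq (h₁ : Tri P σ T₁ Q') (h₂ : ∀ σ', Q' σ' → Tri P' σ' T₂ Q) :
    Tri (.seq P P') σ (T₁ + T₂ + 1) Q := fun k S T' a ha => by
  rw [show T₁ + T₂ + 1 + T' = T₁ + (T₂ + T') + 1 by omega,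
    hitProb_pure (κ' := (P :: P' :: k, σ)) rfl]
  exact h₁ _ S _ a fun σ' hσ' => h₂ σ' hσ' k S T' a ha

theorem Tri.seq_qnt (h₁ : Tri P σ T₁ Q') (h₂ : ∀ σ', Q' σ' → Qnt P' σ' T₂ p Q G) :
    Qnt (.seq P P') σ (T₁ + T₂ + 1) p Q G := fun k S T' a b hab ha hb => by
  rw [show T₁ + T₂ + 1 + T' = T₁ + (T₂ + T') + 1 by omega,
    hitProb_pure (κ' := (P :: P' :: k, σ)) rfl]
  exact h₁ _ S _ _ fun σ' hσ' => h₂ σ' hσ' k S T' a b hab ha hb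

theorem Qnt.seq_tri (h₁ : Qnt P σ T₁ p Q' G') (h₂ : ∀ σ', Q' σ' → Tri P' σ' T₂ Q)
    (h₃ : ∀ σ', Q' σ' → G' σ' → Tri P' σ' T₂ fun τ => Q τ ∧ G τ) :
    Qnt (.seq P P') σ (T₁ + T₂ + 1) p Q G := fun k S T' a b hab ha hb => by
  rw [show T₁ + T₂ + 1 + T' = T₁ + (T₂ + T') + 1 by omega,
    hitProb_pure (κ' := (P :: P' :: k, σ)) rfl]
  exact h₁ _ S _ a b hab (fun σ' hσ' => h₂ σ' hσ' k S T' a ha)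
    fun σ' hσ' hg => h₃ σ' hσ' hg k S T' b fun τ hτ => hb τ hτ.1 hτ.2

theorem Tri.toQnt (h : Tri P σ T fun τ => Q τ ∧ G τ) (hp : p ≤ 1) : Qnt P σ T p Q G :=
  fun k S T' a b hab _ hb => by
    have := h k S T' b fun τ hτ => hb τ hτ.1 hτ.2
    nlinarith

theorem Tri.ite {x : ℕ} (h₁ : σ.reg x ≠ 0 → Tri P σ T Q) (h₂ : σ.reg x = 0 → Tri P' σ T Q) :
    Tri (.ite x P P') σ (T + 1) Q := fun k S T' a ha => by
  rw [show T + 1 + T' = T + T' + 1 by omega,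
    hitProb_pure (κ' := ((if σ.reg x ≠ 0 then P else P') :: k, σ)) rfl]
  split_ifs with h
  · exact h₁ h k S T' a ha
  · exact h₂ (by simpa using h) k S T' a ha

theorem Tri.while_zero {x : ℕ} (hx : σ.reg x = 0) (h : Q σ) : Tri (.while x P) σ 1 Q :=
  .of_step (fun k => by simp [step, hx]) h

theorem hitProb_while {x : ℕ} (hx : σ.reg x ≠ 0) (S : Set Mem) (k : List Prog) :
    hitProb S (T + 1) (.while x P :: k, σ) = hitProb S T (P :: .while x P :: k, σ) :=
  hitProb_pure (by simp [step, hx])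

theorem Tri.while_succ {x : ℕ} (hx : σ.reg x ≠ 0) (h₁ : Tri P σ T₁ Q')
    (h₂ : ∀ σ', Q' σ' → Tri (.while x P) σ' T₂ Q) : Tri (.while x P) σ (T₁ + T₂ + 1) Q :=
  fun k S T' a ha => by
    rw [show T₁ + T₂ + 1 + T' = T₁ + (T₂ + T') + 1 by omega, hitProb_while hx]
    exact h₁ _ S _ a fun σ' hσ' => h₂ σ' hσ' k S T' a ha

/-- Count register `c` down to `0`, running `body` after each decrement; register `1` must
hold `1`. The values of `c` that `body` sees are those below the initial one, in decreasing
order. -/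
def down (c : ℕ) (body : Prog) : Prog := .while c (.seq (.sub c c 1) body)

theorem Tri.sub_one_seq {c j : ℕ} (h1 : σ.reg 1 = 1) (hc : σ.reg c = j + 1)
    (h : Tri P (σ.setReg c j) T Q) : Tri (.seq (.sub c c 1) P) σ (T + 2) Q :=
  (Tri.seq (Tri.sub (Q := fun τ => τ = σ.setReg c j) (by simp [h1, hc]))
    (fun σ' hσ' => by subst hσ'; exact h)).weaken (by omega) fun _ h => h

theorem Tri.sub_one_seq_qnt {c j : ℕ} (h1 : σ.reg 1 = 1) (hc : σ.reg c = j + 1)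
    (h : Qnt P (σ.setReg c j) T p Q G) : Qnt (.seq (.sub c c 1) P) σ (T + 2) p Q G :=
  (Tri.seq_qnt (Tri.sub (Q := fun τ => τ = σ.setReg c j) (by simp [h1, hc]))
    (fun σ' hσ' => by subst hσ'; exact h)).weaken (by omega) le_rfl (fun _ h => h) fun _ _ h => h

theorem Tri.down {c Tb : ℕ} {body : Prog} {I : ℕ → Mem → Prop}
    (hone : ∀ j σ, I j σ → σ.reg 1 = 1)
    (h : ∀ j σ, I (j + 1) σ → σ.reg c = j + 1 →
      Tri body (σ.setReg c j) Tb fun σ' => I j σ' ∧ σ'.reg c = j)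
    (j : ℕ) (σ : Mem) (hI : I j σ) (hc : σ.reg c = j) :
    Tri (down c body) σ (j * (Tb + 3) + 1) (I 0) := by
  induction j generalizing σ with
  | zero => exact (Tri.while_zero hc hI).weaken (by omega) fun _ h => h
  | succ j ih =>
    refine (Tri.while_succ (by omega)
      (Tri.sub_one_seq (hone _ _ hI) hc (h j σ hI hc))
      fun σ' hσ' => ih σ' hσ'.1 hσ'.2).weaken ?_ fun _ h => h
    rw [Nat.succ_mul]; omega

/-- A loop through stages `H j` (`j` rounds to go), each passed with probability at least `q` unless
the goal `G`, which is never lost, has been reached; at stage `0` the goal is reached. -/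
theorem Qnt.down_pow {c Tb : ℕ} {body : Prog} {I G : Mem → Prop} {H : ℕ → Mem → Prop}
    (hq0 : 0 ≤ q) (hq1 : q ≤ 1)
    (hone : ∀ σ, I σ → σ.reg 1 = 1)
    (hI : ∀ j σ, I σ → σ.reg c = j + 1 →
      Tri body (σ.setReg c j) Tb fun σ' => I σ' ∧ σ'.reg c = j)
    (hG : ∀ j σ, I σ → G σ → σ.reg c = j + 1 →
      Tri body (σ.setReg c j) Tb fun σ' => (I σ' ∧ σ'.reg c = j) ∧ G σ')
    (hH : ∀ j σ, I σ → H (j + 1) σ → σ.reg c = j + 1 →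
      Qnt body (σ.setReg c j) Tb q (fun σ' => I σ' ∧ σ'.reg c = j) fun σ' => G σ' ∨ H j σ')
    (h0 : ∀ σ, I σ → H 0 σ → G σ)
    (j : ℕ) (σ : Mem) (hIσ : I σ) (hHσ : H j σ) (hc : σ.reg c = j) :
    Qnt (RandRAM.down c body) σ (j * (Tb + 3) + 1) (q ^ j) I G := by
  induction j generalizing σ with
  | zero =>
    refine Tri.toQnt ((Tri.while_zero hc (Q := fun τ => I τ ∧ G τ)
      ⟨hIσ, h0 σ hIσ hHσ⟩).weaken (by omega) fun _ h => h) (by simp)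
  | succ j ih =>
    intro k S T' a b hab ha hb
    have hT : (j + 1) * (Tb + 3) + 1 + T' = (Tb + 2) + (j * (Tb + 3) + 1 + T') + 1 := by
      rw [Nat.succ_mul]; omega
    rw [hT, RandRAM.down, hitProb_while (by omega)]
    have hqj : q ^ j ≤ 1 := pow_le_one₀ hq0 hq1
    have hqj0 : 0 ≤ q ^ j := pow_nonneg hq0 j
    have key := Tri.sub_one_seq_qnt (hone _ hIσ) hc (hH j σ hIσ hHσ hc)
      (RandRAM.down c body :: k) S (j * (Tb + 3) + 1 + T') a (a + q ^ j * (b - a))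
      (by nlinarith) ?_ ?_
    · refine le_trans (le_of_eq ?_) key
      ring
    · rintro σ' ⟨h1, h2⟩
      exact Tri.down (I := fun _ => I) (fun _ => hone) hI j σ' h1 h2 k S T' a ha
    · rintro σ' ⟨h1, h2⟩ (h3 | h3)
      · have := Tri.down (I := fun _ τ => I τ ∧ G τ) (fun _ τ h => hone τ h.1)
          (fun j σ h hc => (hG j σ h.1 h.2 hc).weaken le_rfl fun τ h => ⟨⟨h.1.1, h.2⟩, h.1.2⟩)
          j σ' ⟨h1, h3⟩ h2 k S T' b fun τ hτ => hb τ hτ.1 hτ.2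
        nlinarith
      · exact ih σ' h1 h3 h2 k S T' a b hab ha hb

/-- Independent attempts: if each round of a loop reaches the goal `G`, which is never lost, with
probability at least `p`, then `j` rounds miss it with probability at most `(1 - p) ^ j`. -/
theorem Qnt.down_trials {c Tb : ℕ} {body : Prog} {I G : Mem → Prop}
    (hp1 : p ≤ 1) (hone : ∀ σ, I σ → σ.reg 1 = 1)
    (hG : ∀ j σ, I σ → G σ → σ.reg c = j + 1 →
      Tri body (σ.setReg c j) Tb fun σ' => (I σ' ∧ σ'.reg c = j) ∧ G σ')
    (hQ : ∀ j σ, I σ → σ.reg c = j + 1 →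
      Qnt body (σ.setReg c j) Tb p (fun σ' => I σ' ∧ σ'.reg c = j) G)
    (j : ℕ) (σ : Mem) (hIσ : I σ) (hc : σ.reg c = j) :
    Qnt (RandRAM.down c body) σ (j * (Tb + 3) + 1) (1 - (1 - p) ^ j) I G := by
  induction j generalizing σ with
  | zero =>
    intro k S T' a b hab ha hb
    simpa [RandRAM.down] using Tri.while_zero (P := .seq (.sub c c 1) body) hc hIσ k S T' a ha
  | succ j ih =>
    intro k S T' a b hab ha hb
    have hT : (j + 1) * (Tb + 3) + 1 + T' = (Tb + 2) + (j * (Tb + 3) + 1 + T') + 1 := by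
      rw [Nat.succ_mul]; omega
    rw [hT, RandRAM.down, hitProb_while (by omega)]
    have hr : 0 ≤ (1 - p) ^ j := pow_nonneg (by linarith) j
    have key := Tri.sub_one_seq_qnt (hone _ hIσ) hc (hQ j σ hIσ hc)
      (RandRAM.down c body :: k) S (j * (Tb + 3) + 1 + T') (a + (1 - (1 - p) ^ j) * (b - a)) b
      (by nlinarith) ?_ ?_
    · refine le_trans (le_of_eq ?_) key
      ring
    · rintro σ' ⟨h1, h2⟩
      exact ih σ' h1 h2 k S T' a b hab ha hb
    · rintro σ' ⟨h1, h2⟩ h3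
      exact Tri.down (I := fun _ τ => I τ ∧ G τ) (fun _ τ h => hone τ h.1)
          (fun j σ h hc => (hG j σ h.1 h.2 hc).weaken le_rfl fun τ h => ⟨⟨h.1.1, h.2⟩, h.1.2⟩)
          j σ' ⟨h1, h3⟩ h2 k S T' b fun τ hτ => hb τ hτ.1 hτ.2

end Rules

/-! ### Symbolic execution and basic subroutines -/

section SymbolicExecution

variable {P : Prog} {σ : Mem} {T : ℕ} {Q : Mem → Prop}

theorem Tri.step_seq {A : Prog} {σ₁ : Mem} (h : ∀ k, step (A :: k, σ) = PMF.pure (k, σ₁))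
    (hP : Tri P σ₁ T Q) : Tri (.seq A P) σ (T + 2) Q :=
  (Tri.seq (Tri.of_step (Q := fun τ => τ = σ₁) h rfl)
    (fun σ' hσ' => by subst hσ'; exact hP)).weaken (by omega) fun _ h => h

theorem Tri.const_seq {x v : ℕ} (h : Tri P (σ.setReg x v) T Q) :
    Tri (.seq (.const x v) P) σ (T + 2) Q := .step_seq (fun _ => rfl) h

theorem Tri.add_seq {x y z : ℕ} (h : Tri P (σ.setReg x (σ.reg y + σ.reg z)) T Q) :
    Tri (.seq (.add x y z) P) σ (T + 2) Q := .step_seq (fun _ => rfl) h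

theorem Tri.sub_seq {x y z : ℕ} (h : Tri P (σ.setReg x (σ.reg y - σ.reg z)) T Q) :
    Tri (.seq (.sub x y z) P) σ (T + 2) Q := .step_seq (fun _ => rfl) h

theorem Tri.load_seq {x a y : ℕ} (h : Tri P (σ.setReg x (σ.arr a (σ.reg y))) T Q) :
    Tri (.seq (.load x a y) P) σ (T + 2) Q := .step_seq (fun _ => rfl) h

theorem Tri.store_seq {x a y : ℕ} (h : Tri P (σ.setArr a (σ.reg x) (σ.reg y)) T Q) :
    Tri (.seq (.store a x y) P) σ (T + 2) Q := .step_seq (fun _ => rfl) h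

end SymbolicExecution

/-- Run `body` with register `c` holding `n - 1, …, 1, 0`, where register `0` holds `n` and register
`2` holds `0`. -/
def forN (c : ℕ) (body : Prog) : Prog := .seq (.add c 0 2) (down c body)

/-- The registers and the array that the algorithm reads but does not change once they are set up:
register `0` holds `n`, registers `1` and `2` hold the constants `1` and `0`, array `0` the
adjacency matrix. -/
structure Env {n : ℕ} (G : SimpleGraph (Fin n)) [DecidableRel G.Adj] (σ : Mem) : Prop where
  reg_zero : σ.reg 0 = n
  reg_one : σ.reg 1 = 1
  reg_two : σ.reg 2 = 0
  adj : ∀ u v : Fin n, σ.arr 0 ((u : ℕ) * n + v) = if G.Adj u v then 1 else 0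

/-- The two memories agree on the registers below `b`. -/
def Frame (b : ℕ) (σ σ' : Mem) : Prop := ∀ r < b, σ'.reg r = σ.reg r

/-- The subset of `Fin n` that an array represents: the indices of its nonzero cells. -/
def arrSet (n : ℕ) (f : ℕ → ℕ) : Finset (Fin n) := Finset.univ.filter fun v => f v ≠ 0

theorem mem_arrSet {n : ℕ} {f : ℕ → ℕ} {v : Fin n} : v ∈ arrSet n f ↔ f v ≠ 0 := by
  simp [arrSet]

theorem Frame.refl (b : ℕ) (σ : Mem) : Frame b σ σ := fun _ _ => rfl

theorem Frame.trans {b : ℕ} {σ σ' σ'' : Mem} (h : Frame b σ σ') (h' : Frame b σ' σ'') :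
    Frame b σ σ'' := fun r hr => (h' r hr).trans (h r hr)

theorem Frame.mono {b b' : ℕ} {σ σ' : Mem} (h : Frame b σ σ') (hb : b' ≤ b) : Frame b' σ σ' :=
  fun r hr => h r (by omega)

theorem Frame.setReg {b : ℕ} {σ σ' : Mem} (h : Frame b σ σ') {x v : ℕ} (hx : b ≤ x) :
    Frame b σ (σ'.setReg x v) := fun r hr => by
  simp [show r ≠ x by omega, h r hr]

theorem Frame.setReg_left {b : ℕ} {σ σ' : Mem} {x v : ℕ} (h : Frame b (σ.setReg x v) σ')
    (hx : b ≤ x) : Frame b σ σ' := fun r hr => by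
  simpa [show r ≠ x by omega] using h r hr

theorem Frame.setArr {b : ℕ} {σ σ' : Mem} (h : Frame b σ σ') {a i v : ℕ} :
    Frame b σ (σ'.setArr a i v) := h

section Subroutines

variable {n : ℕ} {G : SimpleGraph (Fin n)} [DecidableRel G.Adj] {σ : Mem}

theorem Env.of_frame {σ' : Mem} {b : ℕ} (h : Env G σ) (hf : Frame b σ σ') (hb : 3 ≤ b)
    (ha : σ'.arr 0 = σ.arr 0) : Env G σ' :=
  ⟨by rw [hf 0 (by omega), h.reg_zero], by rw [hf 1 (by omega), h.reg_one],
    by rw [hf 2 (by omega), h.reg_two], by rw [ha]; exact h.adj⟩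

theorem Env.setReg (h : Env G σ) {x v : ℕ} (hx : 3 ≤ x) : Env G (σ.setReg x v) :=
  h.of_frame ((Frame.refl 3 σ).setReg hx) le_rfl rfl

theorem Tri.forN {c Tb : ℕ} {body : Prog} {I : ℕ → Mem → Prop} (hσ : Env G σ)
    (h0 : I n (σ.setReg c n)) (hone : ∀ j σ, I j σ → σ.reg 1 = 1)
    (h : ∀ j σ, j < n → I (j + 1) σ → σ.reg c = j + 1 →
      Tri body (σ.setReg c j) Tb fun σ' => I j σ' ∧ σ'.reg c = j) :
    Tri (forN c body) σ (n * (Tb + 3) + 3) (I 0) := by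
  refine (Tri.add_seq (T := n * (Tb + 3) + 1) ?_).weaken (by omega) fun _ h => h
  refine (Tri.down (I := fun j τ => j ≤ n ∧ I j τ) (fun j τ hτ => hone j τ hτ.2) ?_ n _ ?_ ?_).weaken
    le_rfl fun _ h => h.2
  · intro j τ hτ hc
    exact (h j τ hτ.1 hτ.2 hc).weaken le_rfl fun τ' h' => ⟨⟨by omega, h'.1⟩, h'.2⟩
  · simpa [hσ.reg_zero, hσ.reg_two] using h0
  · simp [hσ.reg_zero, hσ.reg_two]

theorem card_filter_le_val (p : Fin n → Prop) [DecidablePred p] {j : ℕ} (hj : j < n) :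
    (Finset.univ.filter fun v : Fin n => j ≤ v ∧ p v).card
      = (Finset.univ.filter fun v : Fin n => j + 1 ≤ v ∧ p v).card
        + if p ⟨j, hj⟩ then 1 else 0 := by
  split_ifs with h
  · rw [← Finset.card_insert_of_notMem (a := (⟨j, hj⟩ : Fin n)) (by simp)]
    congr 1
    ext v
    simp only [Finset.mem_filter, Finset.mem_univ, true_and, Finset.mem_insert, Fin.ext_iff]
    constructor
    · rintro ⟨h1, h2⟩
      rcases h1.eq_or_lt with h1 | h1
      · exact .inl h1.symm
      · exact .inr ⟨h1, h2⟩
    · rintro (h1 | ⟨h1, h2⟩)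
      · have : v = ⟨j, hj⟩ := Fin.ext h1
        subst this
        exact ⟨le_rfl, h⟩
      · exact ⟨by omega, h2⟩
  · rw [Nat.add_zero]
    congr 1
    ext v
    simp only [Finset.mem_filter, Finset.mem_univ, true_and]
    refine ⟨fun ⟨h1, h2⟩ => ⟨?_, h2⟩, fun ⟨h1, h2⟩ => ⟨by omega, h2⟩⟩
    rcases h1.eq_or_lt with h1 | h1
    · have : v = ⟨j, hj⟩ := Fin.ext h1.symm
      exact absurd (this ▸ h2) h
    · exact h1

theorem card_filter_le_val_top (p : Fin n → Prop) [DecidablePred p] :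
    (Finset.univ.filter fun v : Fin n => n ≤ v ∧ p v).card = 0 :=
  Finset.card_eq_zero.2 (Finset.filter_eq_empty_iff.2 fun v _ h => absurd h.1 (by omega))

/-- Register `32` receives the adjacency of the vertices in registers `u` and `v`. -/
def adjP (u v : ℕ) : Prog :=
  .seq (.add 31 v 2) (.seq (.add 30 u 2) (.seq (down 30 (.add 31 31 0)) (.load 32 0 31)))

theorem tri_adjP (hσ : Env G σ) {ru rv : ℕ} (hu : ru < 30) {u v : Fin n}
    (hru : σ.reg ru = u) (hrv : σ.reg rv = v) :
    Tri (adjP ru rv) σ (4 * n + 8) fun σ' => Frame 30 σ σ' ∧ σ'.arr = σ.arr ∧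
      σ'.reg 32 = if G.Adj u v then 1 else 0 := by
  refine (Tri.add_seq (Tri.add_seq (Tri.seq (Tri.down
    (I := fun j τ => Frame 30 σ τ ∧ τ.arr = σ.arr ∧ τ.reg 31 + j * n = u * n + v) (Tb := 1)
    ?_ ?_ (u : ℕ) _ ?_ ?_) ?_))).weaken (T := (u : ℕ) * (1 + 3) + 1 + 1 + 1 + 2 + 2) ?_
    fun _ h => h
  · intro j τ hτ
    rw [hτ.1 1 (by omega), hσ.reg_one]
  · rintro j τ ⟨h1, h2, h3⟩ hc
    refine Tri.add ⟨⟨(h1.setReg (by omega)).setReg (by omega), h2, ?_⟩, by simp⟩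
    simp [h1 0 (by omega), hσ.reg_zero]
    rw [← h3]; ring
  · refine ⟨((Frame.refl _ _).setReg (by omega)).setReg (by omega), rfl, ?_⟩
    simp [hrv, hσ.reg_two]; ring
  · simp [show ru ≠ 31 by omega, hru, hσ.reg_two]
  · rintro τ ⟨h1, h2, h3⟩
    refine Tri.load ⟨h1.setReg (by omega), h2, ?_⟩
    rw [← hσ.adj u v]
    simp [h2, ← h3]
  · have := u.2
    omega

/-- The number of neighbours of `u` outside `W`. -/
def rdeg (G : SimpleGraph (Fin n)) [DecidableRel G.Adj] (W : Finset (Fin n)) (u : Fin n) : ℕ :=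
  (Finset.univ.filter fun v => G.Adj u v ∧ v ∉ W).card

/-- Register `21` receives the number of neighbours, outside the set in array `2`, of the vertex in
register `u`. -/
def degP (u : ℕ) : Prog :=
  .seq (.const 21 0) (forN 20 (.seq (adjP u 20)
    (.ite 32 (.seq (.load 33 2 20) (.ite 33 .skip (.add 21 21 1))) .skip)))

theorem tri_degP (hσ : Env G σ) {ru : ℕ} (hu : ru < 20) {u : Fin n} (hru : σ.reg ru = u) :
    Tri (degP ru) σ (n * (4 * n + 17) + 5) fun σ' => Frame 20 σ σ' ∧ σ'.arr = σ.arr ∧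
      σ'.reg 21 = rdeg G (arrSet n (σ.arr 2)) u := by
  refine (Tri.const_seq (Tri.forN (G := G) (I := fun j τ => Frame 20 σ τ ∧ τ.arr = σ.arr ∧
    τ.reg 21 = (Finset.univ.filter fun v : Fin n =>
      j ≤ v ∧ G.Adj u v ∧ v ∉ arrSet n (σ.arr 2)).card) (Tb := 4 * n + 14)
    (hσ.setReg (by omega)) ?_ ?_ ?_)).weaken (by ring_nf; omega) ?_
  · refine ⟨((Frame.refl _ _).setReg (by omega)).setReg (by omega), rfl, ?_⟩
    simp [card_filter_le_val_top]
  · rintro j τ ⟨h1, -⟩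
    rw [h1 1 (by omega), hσ.reg_one]
  · rintro j τ hj ⟨h1, h2, h3⟩ hc
    have hE : Env G (τ.setReg 20 j) := (hσ.of_frame h1 (by omega) (by rw [h2])).setReg (by omega)
    refine (Tri.seq (tri_adjP hE (by omega : ru < 30) (u := u)
      (v := ⟨j, hj⟩) ?_ ?_) (T₂ := 5) ?_).weaken (by omega) fun _ h => h
    · simp [show ru ≠ 20 by omega, h1 ru hu, hru]
    · simp
    · rintro τ' ⟨k1, k2, k3⟩
      have hF : Frame 20 σ τ' := h1.trans ((k1.mono (by omega)).setReg_left le_rfl)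
      have k20 : τ'.reg 20 = j := by rw [k1 20 (by omega)]; simp
      have k21 : τ'.reg 21 = τ.reg 21 := by rw [k1 21 (by omega)]; simp
      have k2' : τ'.arr = σ.arr := by rw [k2, ← h2]; rfl
      have hstep := card_filter_le_val (fun v => G.Adj u v ∧ v ∉ arrSet n (σ.arr 2)) hj
      have hmem : ⟨j, hj⟩ ∈ arrSet n (σ.arr 2) ↔ _ := mem_arrSet
      refine Tri.ite (fun ha => ?_) fun ha => ?_
      · have hadj : G.Adj u ⟨j, hj⟩ := by
          by_contra hcon; exact ha (by rw [k3, if_neg hcon])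
        refine Tri.load_seq (Tri.ite (T := 1) (fun hb => ?_) fun hb => ?_)
        · refine Tri.skip ⟨⟨hF.setReg (by omega), k2', ?_⟩, by simp [k20]⟩
          simp [k20, k2'] at hb
          simp [k21, h3, hstep, hmem, hb]
        · refine Tri.add ⟨⟨(hF.setReg (by omega)).setReg (by omega), k2', ?_⟩, by simp [k20]⟩
          simp [k20, k2'] at hb
          have h1' : τ'.reg 1 = 1 := by rw [hF 1 (by omega), hσ.reg_one]
          simp [k21, h3, hstep, hmem, hb, hadj, h1']
      · have hadj : ¬ G.Adj u ⟨j, hj⟩ := by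
          intro hcon; rw [k3, if_pos hcon] at ha; omega
        refine (Tri.skip (Q := fun τ' => _) ⟨⟨hF, k2', ?_⟩, k20⟩).weaken (by omega) fun _ h => h
        simp [k21, h3, hstep, hadj]
  · rintro τ ⟨h1, h2, h3⟩
    exact ⟨h1, h2, by simpa [rdeg] using h3⟩

/-- Fill the first `n` cells of array `a` with the content of register `x`. -/
def fillP (a x : ℕ) : Prog := forN 10 (.store a 10 x)

theorem tri_fillP (hσ : Env G σ) {a x : ℕ} (hx : x < 10) :
    Tri (fillP a x) σ (n * 4 + 3) fun σ' => Frame 10 σ σ' ∧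
      (∀ b ≠ a, σ'.arr b = σ.arr b) ∧ ∀ v < n, σ'.arr a v = σ.reg x := by
  refine (Tri.forN (G := G) (Tb := 1) (I := fun j τ => Frame 10 σ τ ∧
    (∀ b ≠ a, τ.arr b = σ.arr b) ∧ ∀ v < n, j ≤ v → τ.arr a v = σ.reg x) hσ ?_ ?_ ?_).weaken
    (by omega) fun τ h => ⟨h.1, h.2.1, fun v hv => h.2.2 v hv (by omega)⟩
  · exact ⟨(Frame.refl _ _).setReg (by omega), fun _ _ => rfl, fun v _ _ => by omega⟩
  · rintro j τ ⟨h1, -⟩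
    rw [h1 1 (by omega), hσ.reg_one]
  · rintro j τ hj ⟨h1, h2, h3⟩ hc
    refine Tri.store ⟨⟨(h1.setReg (by omega)).setArr, fun b hb => ?_, fun v hv hjv => ?_⟩, by simp⟩
    · ext i; simp [hb, h2 b hb]
    · have := h1 x hx
      have := h3 v hv
      simp [show x ≠ 10 by omega]
      grind

/-- Copy the first `n` cells of array `a` to array `b`. -/
def copyP (a b : ℕ) : Prog := forN 10 (.seq (.load 11 a 10) (.store b 10 11))

theorem tri_copyP (hσ : Env G σ) {a b : ℕ} (hab : a ≠ b) :
    Tri (copyP a b) σ (n * 6 + 3) fun σ' => Frame 10 σ σ' ∧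
      (∀ d ≠ b, σ'.arr d = σ.arr d) ∧ ∀ v < n, σ'.arr b v = σ.arr a v := by
  refine (Tri.forN (G := G) (Tb := 3) (I := fun j τ => Frame 10 σ τ ∧
    (∀ d ≠ b, τ.arr d = σ.arr d) ∧ ∀ v < n, j ≤ v → τ.arr b v = σ.arr a v) hσ ?_ ?_ ?_).weaken
    (by omega) fun τ h => ⟨h.1, h.2.1, fun v hv => h.2.2 v hv (by omega)⟩
  · exact ⟨(Frame.refl _ _).setReg (by omega), fun _ _ => rfl, fun v _ _ => by omega⟩
  · rintro j τ ⟨h1, -⟩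
    rw [h1 1 (by omega), hσ.reg_one]
  · rintro j τ hj ⟨h1, h2, h3⟩ hc
    refine Tri.load_seq (Tri.store ⟨⟨((h1.setReg (by omega)).setReg (by omega)).setArr,
      fun d hd => ?_, fun v hv hjv => ?_⟩, by simp⟩)
    · ext i; simp [hd, h2 d hd]
    · have := h3 v hv
      have := h2 a hab
      simp
      grind

/-- Register `13` receives the size of the set in array `a`. -/
def countP (a : ℕ) : Prog :=
  .seq (.const 13 0) (forN 12 (.seq (.load 14 a 12) (.ite 14 (.add 13 13 1) .skip)))

theorem tri_countP (hσ : Env G σ) (a : ℕ) :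
    Tri (countP a) σ (n * 7 + 5) fun σ' => Frame 12 σ σ' ∧ σ'.arr = σ.arr ∧
      σ'.reg 13 = (arrSet n (σ.arr a)).card := by
  refine (Tri.const_seq (Tri.forN (G := G) (Tb := 4) (I := fun j τ => Frame 12 σ τ ∧
    τ.arr = σ.arr ∧ τ.reg 13 = (Finset.univ.filter fun v : Fin n => j ≤ v ∧ σ.arr a v ≠ 0).card)
    (hσ.setReg (by omega)) ?_ ?_ ?_)).weaken (by omega)
    fun τ h => ⟨h.1, h.2.1, by simpa [arrSet] using h.2.2⟩
  · refine ⟨((Frame.refl _ _).setReg (by omega)).setReg (by omega), rfl, ?_⟩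
    simp [card_filter_le_val_top]
  · rintro j τ ⟨h1, -⟩
    rw [h1 1 (by omega), hσ.reg_one]
  · rintro j τ hj ⟨h1, h2, h3⟩ hc
    have hstep := card_filter_le_val (fun v : Fin n => σ.arr a v ≠ 0) hj
    have h1' := h1 1 (by omega)
    rw [hσ.reg_one] at h1'
    have hF := (h1.setReg (x := 12) (v := j) le_rfl).setReg (x := 14) (v := τ.arr a j) (by omega)
    refine Tri.load_seq ?_
    simp only [Mem.setReg_reg, Mem.setReg_arr, if_true]
    refine Tri.ite (T := 1) (fun hb => ?_) fun hb => ?_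
    · refine Tri.add ⟨⟨hF.setReg (by omega), h2, ?_⟩, by simp⟩
      simp [h2] at hb
      simp [h3, hstep, hb, h1']
    · refine Tri.skip ⟨⟨hF, h2, ?_⟩, by simp⟩
      simp [h2] at hb
      simp [h3, hstep, hb]

end Subroutines

/-! ### Extending a set to a vertex cover -/

theorem Qnt.toTri {P : Prog} {σ : Mem} {T : ℕ} {p : ℝ} {Q G : Mem → Prop}
    (h : Qnt P σ T p Q G) : Tri P σ T Q := fun k S T' a ha => by
  simpa using h k S T' a a le_rfl ha fun σ' h' _ => ha σ' h'

section Algorithm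

variable {n : ℕ} {G : SimpleGraph (Fin n)}

theorem arrSet_congr {f g : ℕ → ℕ} (h : ∀ v < n, f v = g v) : arrSet n f = arrSet n g := by
  ext v; simp [mem_arrSet, h v v.2]

theorem arrSet_setArr (σ : Mem) (a : ℕ) (u : Fin n) {x : ℕ} (hx : x ≠ 0) :
    arrSet n ((σ.setArr a u x).arr a) = insert u (arrSet n (σ.arr a)) := by
  ext v
  simp only [mem_arrSet, Mem.setArr_arr, true_and, Finset.mem_insert, Fin.ext_iff]
  grind

/-- `C` arises from `W` by adding the ends of disjoint edges of `G - W`. As every vertex cover `O`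
contains an end of each of these edges, adding them is paid for by the decrease of `|O \ C|` in
`bound`. The edges among the pairs in `D` are covered by `C`. -/
structure MatchedExt (G : SimpleGraph (Fin n)) (W C : Finset (Fin n))
    (D : Fin n → Fin n → Prop) : Prop where
  sub : W ⊆ C
  bound : ∀ O : Finset (Fin n), G.IsVertexCover (O : Set (Fin n)) →
    C.card + 2 * (O \ C).card ≤ W.card + 2 * (O \ W).card
  cover : ∀ u v, D u v → G.Adj u v → u ∈ C ∨ v ∈ C

theorem MatchedExt.mono {W C : Finset (Fin n)} {D D' : Fin n → Fin n → Prop}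
    (h : MatchedExt G W C D)
    (hD : ∀ u v, D' u v → G.Adj u v → D u v ∨ u ∈ C ∨ v ∈ C) : MatchedExt G W C D' :=
  ⟨h.sub, h.bound, fun u v huv ha => (hD u v huv ha).elim (fun h' => h.cover u v h' ha) id⟩

theorem MatchedExt.insert {W C : Finset (Fin n)} {D : Fin n → Fin n → Prop}
    (h : MatchedExt G W C D) {u v : Fin n} (ha : G.Adj u v) (hu : u ∉ C) (hv : v ∉ C) :
    MatchedExt G W (insert v (insert u C)) D := by
  refine ⟨h.sub.trans ((Finset.subset_insert _ _).trans (Finset.subset_insert _ _)), fun O hO => ?_,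
    fun x y hxy ha => ?_⟩
  · have h1 := h.bound O hO
    have h2 : (Insert.insert v (Insert.insert u C)).card = C.card + 2 := by
      rw [Finset.card_insert_of_notMem (by simp [ha.ne', hv]), Finset.card_insert_of_notMem hu]
    have h3 : (O \ Insert.insert v (Insert.insert u C)).card < (O \ C).card := by
      refine Finset.card_lt_card (Finset.ssubset_iff_of_subset ?_ |>.2 ?_)
      · intro x; simp; tauto
      · rcases hO ha with h' | h'
        · exact ⟨u, by simpa using ⟨h', hu⟩, by simp⟩
        · exact ⟨v, by simpa using ⟨h', hv⟩, by simp⟩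
    omega
  · rcases h.cover x y hxy ha with h' | h' <;> simp [h']

variable [DecidableRel G.Adj] {σ : Mem}

/-- Extend the set in array `2` greedily by the ends of a maximal matching of the remaining graph to
a vertex cover, in array `3`. -/
def matchP : Prog := .seq (copyP 2 3) (forN 10 (forN 11 (.seq (adjP 10 11)
  (.ite 32 (.seq (.load 33 3 10) (.ite 33 .skip (.seq (.load 33 3 11)
    (.ite 33 .skip (.seq (.store 3 10 1) (.store 3 11 1)))))) .skip))))

theorem tri_matchP (hσ : Env G σ) :
    Tri matchP σ (n * (n * (4 * n + 22) + 12) + 7) fun σ' => Frame 10 σ σ' ∧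
      (∀ b ≠ 3, σ'.arr b = σ.arr b) ∧
      MatchedExt G (arrSet n (σ.arr 2)) (arrSet n (σ'.arr 3))
        fun _ _ => True := by
  set W := arrSet n (σ.arr 2) with hW
  refine (Tri.seq (tri_copyP hσ (by omega : 2 ≠ 3)) (T₂ := n * (n * (4 * n + 22) + 6) + 3)
    ?_).weaken (by ring_nf; omega) fun τ h => h
  rintro σ₁ ⟨f1, f2, f3⟩
  have hσ₁ : Env G σ₁ := hσ.of_frame f1 (by omega) (f2 0 (by omega))
  refine (Tri.forN (G := G) (I := fun j τ => Frame 10 σ τ ∧ (∀ b ≠ 3, τ.arr b = σ.arr b) ∧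
    MatchedExt G W (arrSet n (τ.arr 3)) fun u _ => j ≤ u) (Tb := n * (4 * n + 22) + 3)
    hσ₁ ?_ ?_ ?_).weaken (by ring_nf; omega) ?_
  · refine ⟨f1.setReg le_rfl, f2, ?_⟩
    rw [show arrSet n ((σ₁.setReg 10 n).arr 3) = W from arrSet_congr f3]
    exact ⟨subset_rfl, fun _ _ => le_rfl, fun u v h => by omega⟩
  · rintro j τ ⟨h1, -⟩
    rw [h1 1 (by omega), hσ.reg_one]
  · rintro j τ hj ⟨h1, h2, h3⟩ hc
    refine (Tri.forN (G := G) (I := fun i τ => Frame 10 σ τ ∧ τ.reg 10 = j ∧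
      (∀ b ≠ 3, τ.arr b = σ.arr b) ∧ MatchedExt G W (arrSet n (τ.arr 3))
        fun u v => j + 1 ≤ u ∨ (u : ℕ) = j ∧ i ≤ v) (Tb := 4 * n + 19)
      ((hσ.of_frame h1 (by omega) (h2 0 (by omega))).setReg (by omega)) ?_ ?_ ?_).weaken
      (by ring_nf; omega) ?_
    · refine ⟨(h1.setReg le_rfl).setReg (by omega), by simp, h2, h3.mono fun u v h _ => .inl ?_⟩
      have := v.2
      omega
    · rintro i τ ⟨h1, -⟩
      rw [h1 1 (by omega), hσ.reg_one]
    · rintro i τ hi ⟨h1, h10, h2, h3⟩ hc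
      have hE : Env G (τ.setReg 11 i) :=
        (hσ.of_frame h1 (by omega) (h2 0 (by omega))).setReg (by omega)
      refine (Tri.seq (tri_adjP hE (by omega : 10 < 30) (rv := 11) (u := ⟨j, hj⟩) (v := ⟨i, hi⟩)
        (by simpa using h10) (by simp)) (T₂ := 10) ?_).weaken (by omega) fun _ h => h
      rintro τ' ⟨k1, k2, k3⟩
      have hF : Frame 10 σ τ' := h1.trans ((k1.mono (by omega)).setReg_left (by omega))
      have k10 : τ'.reg 10 = j := by rw [k1 10 (by omega)]; simpa using h10
      have k11 : τ'.reg 11 = i := by rw [k1 11 (by omega)]; simp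
      have kone : τ'.reg 1 = 1 := by rw [hF 1 (by omega), hσ.reg_one]
      have k2' : ∀ b ≠ 3, τ'.arr b = σ.arr b := fun b hb => by rw [k2]; exact h2 b hb
      rw [show τ.arr = τ'.arr from k2.symm] at h3
      set C := arrSet n (τ'.arr 3) with hC
      -- no change is needed if the pair `(j, i)` is not an uncovered edge
      have hskip : (G.Adj ⟨j, hj⟩ ⟨i, hi⟩ → ⟨j, hj⟩ ∈ C ∨ ⟨i, hi⟩ ∈ C) →
          MatchedExt G W C fun u v => j + 1 ≤ u ∨ (u : ℕ) = j ∧ i ≤ v := fun hc =>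
        h3.mono fun u v h ha => by
          by_cases huv : u = ⟨j, hj⟩ ∧ v = ⟨i, hi⟩
          · obtain ⟨rfl, rfl⟩ := huv
            exact .inr (hc ha)
          · rw [Fin.ext_iff, Fin.ext_iff] at huv
            simp only at huv
            exact .inl (by omega)
      have hmem : ∀ w : Fin n, w ∈ C ↔ τ'.arr 3 w ≠ 0 := fun w => mem_arrSet
      refine Tri.ite (fun ha => ?_) fun ha => ?_
      · have hadj : G.Adj ⟨j, hj⟩ ⟨i, hi⟩ := by
          by_contra hcon; exact ha (by rw [k3, if_neg hcon])
        refine Tri.load_seq (Tri.ite (T := 6) (fun hb => ?_) fun hb => ?_)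
        · refine (Tri.skip (Q := fun τ' => _)
            ⟨⟨hF.setReg (by omega), by simp [k10], k2', hskip fun _ => .inl ?_⟩,
              by simp [k11]⟩).weaken (by omega) fun _ h => h
          rw [hmem]
          simpa [k10] using hb
        · refine Tri.load_seq (Tri.ite (T := 3) (fun hb' => ?_) fun hb' => ?_)
          · refine (Tri.skip (Q := fun τ' => _)
              ⟨⟨(hF.setReg (by omega)).setReg (by omega), by simp [k10], k2',
                hskip fun _ => .inr ?_⟩, by simp [k11]⟩).weaken (by omega) fun _ h => h
            rw [hmem]
            simpa [k11] using hb'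
          · refine Tri.store_seq (Tri.store ⟨⟨(((hF.setReg (by omega)).setReg
              (by omega)).setArr).setArr, by simp [k10], fun b hb => ?_, ?_⟩, by simp [k11]⟩)
            · ext x; simp [hb, k2' b hb]
            · have hj' : (⟨j, hj⟩ : Fin n) ∉ C := by
                rw [hmem]; simpa [k10] using hb
              have hi' : (⟨i, hi⟩ : Fin n) ∉ C := by
                rw [hmem]; simpa [k11] using hb'
              have hnew := h3.insert hadj hj' hi'
              simp only [Mem.setArr_reg, Mem.setReg_reg, show (10 : ℕ) ≠ 33 by omega,
                show (11 : ℕ) ≠ 33 by omega, show (1 : ℕ) ≠ 33 by omega, if_false, k10, k11, kone]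
              rw [arrSet_setArr _ 3 ⟨i, hi⟩ one_ne_zero, arrSet_setArr _ 3 ⟨j, hj⟩ one_ne_zero]
              refine hnew.mono fun u v h _ => ?_
              by_cases huv : u = ⟨j, hj⟩
              · exact .inr (.inl (by simp [huv]))
              · rw [Fin.ext_iff] at huv
                simp only at huv
                exact .inl (.inl (by omega))
      · have hadj : ¬ G.Adj ⟨j, hj⟩ ⟨i, hi⟩ := by
          intro hcon; rw [k3, if_pos hcon] at ha; omega
        exact (Tri.skip (Q := fun τ' => _) ⟨⟨hF, k10, k2', hskip fun h => absurd h hadj⟩,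
          k11⟩).weaken (by omega) fun _ h => h
    · rintro τ' ⟨h1, h10, h2, h3⟩
      exact ⟨⟨h1, h2, h3.mono fun u v h _ => .inl (by omega)⟩, h10⟩
  · rintro τ ⟨h1, h2, h3⟩
    exact ⟨h1, h2, h3.mono fun u v _ _ => .inl (by omega)⟩

/-- Copy array `3` to array `1` if its set is smaller. -/
def updateP : Prog := .seq (countP 3) (.seq (.add 10 13 2) (.seq (countP 1)
  (.seq (.sub 11 13 10) (.ite 11 (copyP 3 1) .skip))))

theorem tri_updateP (hσ : Env G σ) :
    Tri updateP σ (n * 20 + 20) fun σ' => Frame 10 σ σ' ∧ (∀ b ≠ 1, σ'.arr b = σ.arr b) ∧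
      (arrSet n (σ'.arr 1) = arrSet n (σ.arr 1) ∨ arrSet n (σ'.arr 1) = arrSet n (σ.arr 3)) ∧
      (arrSet n (σ'.arr 1)).card ≤ (arrSet n (σ.arr 1)).card ∧
      (arrSet n (σ'.arr 1)).card ≤ (arrSet n (σ.arr 3)).card := by
  refine (Tri.seq (tri_countP hσ 3) (T₂ := 13 * n + 14) ?_).weaken (by ring_nf; omega)
    fun _ h => h
  rintro σ₁ ⟨f1, f2, f3⟩
  have hσ₁ := hσ.of_frame f1 (by omega) (by rw [f2])
  refine Tri.add_seq ?_
  refine (Tri.seq (tri_countP (hσ₁.setReg (by omega)) 1) (T₂ := 6 * n + 6) ?_).weaken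
    (by omega) fun _ h => h
  rintro σ₂ ⟨g1, g2, g3⟩
  have hF : Frame 10 σ σ₂ :=
    (f1.mono (by omega)).trans ((g1.mono (by omega)).setReg_left (by omega))
  have h10 : σ₂.reg 10 = (arrSet n (σ.arr 3)).card := by
    rw [g1 10 (by omega)]; simp [f3, hσ₁.reg_two]
  have hA : σ₂.arr = σ.arr := by rw [g2, ← f2]; rfl
  simp only [Mem.setReg_arr, f2] at g3
  refine Tri.sub_seq ?_
  have hσ₂ := hσ.of_frame hF (by omega) (by rw [hA])
  refine Tri.ite (T := 6 * n + 3) (fun h => ?_) fun h => ?_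
  · refine (tri_copyP (hσ₂.setReg (x := 11) (by omega)) (by omega : 3 ≠ 1)).weaken (by omega) ?_
    rintro τ ⟨k1, k2, k3⟩
    simp only [Mem.setReg_reg, if_true, h10, g3] at h
    have h1 : arrSet n (τ.arr 1) = arrSet n (σ.arr 3) :=
      arrSet_congr fun v hv => by rw [k3 v hv]; simp [hA]
    refine ⟨hF.trans (k1.setReg_left (by omega)), fun b hb => by rw [k2 b hb]; simp [hA],
      .inr h1, ?_, ?_⟩ <;> rw [h1]
    omega
  · simp only [Mem.setReg_reg, if_true, h10, g3] at h
    refine (Tri.skip (Q := fun τ => _) ⟨hF.setReg (by omega), fun b _ => by simp [hA],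
      .inl (by simp [hA]), by simp [hA], ?_⟩).weaken (by omega) fun _ h => h
    simp only [Mem.setReg_arr, hA]
    omega

end Algorithm

/-! ### Random numbers and the growth of the partial cover -/

section Sampling

theorem Qnt.step_seq {A P : Prog} {σ σ₁ : Mem} {T : ℕ} {p : ℝ} {Q G : Mem → Prop}
    (h : ∀ k, step (A :: k, σ) = PMF.pure (k, σ₁)) (hP : Qnt P σ₁ T p Q G) :
    Qnt (.seq A P) σ (T + 2) p Q G :=
  (Tri.seq_qnt (Tri.of_step (Q := fun τ => τ = σ₁) h rfl)
    (fun σ' hσ' => by subst hσ'; exact hP)).weaken (by omega) le_rfl (fun _ h => h) fun _ _ h => h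

variable {n : ℕ} {G : SimpleGraph (Fin n)} [DecidableRel G.Adj] {σ : Mem}

/-- The body of the sampling loop: append a random bit to register `7`, double register `10`. -/
def sampleBody : Prog := .seq (.flip 13) (.seq (.add 7 7 7) (.seq (.add 7 7 13)
  (.seq (.add 10 10 10) (.sub 12 11 10))))

/-- Register `7` receives a uniform random number below the least power of `2` that is at
least `2 n`. -/
def sampleP : Prog := .seq (.const 7 0) (.seq (.const 10 1) (.seq (.add 11 0 0)
  (.seq (.sub 12 11 10) (.while 12 sampleBody))))

theorem hitProb_flip_seq (S : Set Mem) (T x : ℕ) (k : List Prog) (P : Prog) (σ : Mem) :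
    hitProb S (T + 2) (.seq (.flip x) P :: k, σ)
      = (hitProb S T (P :: k, σ.setReg x 0) + hitProb S T (P :: k, σ.setReg x 1)) / 2 := by
  rw [hitProb_pure (κ' := (.flip x :: P :: k, σ)) rfl, hitProb_flip]

theorem sum_range_two_pow_succ (g : ℕ → ℝ) (x d : ℕ) :
    ∑ y ∈ Finset.range (2 ^ (d + 1)), g (x * 2 ^ (d + 1) + y)
      = ∑ y ∈ Finset.range (2 ^ d), g ((x + x) * 2 ^ d + y)
        + ∑ y ∈ Finset.range (2 ^ d), g ((x + x + 1) * 2 ^ d + y) := by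
  rw [pow_succ, Nat.mul_two, Finset.sum_range_add]
  congr 1 <;> refine Finset.sum_congr rfl fun y _ => congrArg g (by ring)

/-- While register `10` holds the power `2 ^ i`, register `7` is uniform below `2 ^ i`; here `d`
doublings remain, which turn the value `x` of register `7` into a uniform element of
`[x * 2 ^ d, (x + 1) * 2 ^ d)`. -/
theorem hitProb_sampleLoop (k : List Prog) (S : Set Mem) (T' : ℕ) (g : ℕ → ℝ) {σ₀ : Mem} {m d : ℕ}
    (hg : ∀ x σ', Frame 7 σ₀ σ' → σ'.arr = σ₀.arr → σ'.reg 7 = x → g x ≤ hitProb S T' (k, σ'))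
    (σ : Mem) (hf : Frame 7 σ₀ σ) (ha : σ.arr = σ₀.arr) (h11 : σ.reg 11 = m)
    (h12 : σ.reg 12 = m - σ.reg 10) (hd : m ≤ σ.reg 10 * 2 ^ d)
    (hd' : ∀ i < d, σ.reg 10 * 2 ^ i < m) :
    (∑ y ∈ Finset.range (2 ^ d), g (σ.reg 7 * 2 ^ d + y)) / 2 ^ d
      ≤ hitProb S (10 * d + 1 + T') (.while 12 sampleBody :: k, σ) := by
  induction d generalizing σ with
  | zero =>
    have h0 : σ.reg 12 = 0 := by rw [h12]; simp at hd; omega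
    simpa using Tri.while_zero (P := sampleBody) h0 (Q := fun τ => τ = σ) rfl k S T'
      (g (σ.reg 7)) fun τ hτ => by subst hτ; exact hg _ _ hf ha rfl
  | succ d ih =>
    have h0 : σ.reg 12 ≠ 0 := by have := hd' 0 (by omega); simp at this; omega
    have key : ∀ b : ℕ, (∑ y ∈ Finset.range (2 ^ d), g ((σ.reg 7 + σ.reg 7 + b) * 2 ^ d + y)) / 2 ^ d
        ≤ hitProb S (7 + (10 * d + 1 + T')) (.seq (.add 7 7 7) (.seq (.add 7 7 13)
            (.seq (.add 10 10 10) (.sub 12 11 10))) :: .while 12 sampleBody :: k,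
            σ.setReg 13 b) := by
      intro b
      refine Tri.add_seq (Tri.add_seq (Tri.add_seq (Tri.sub (Q := fun τ => τ = _) rfl)))
        (.while 12 sampleBody :: k) S (10 * d + 1 + T') _ fun τ hτ => ?_
      have e7 : τ.reg 7 = σ.reg 7 + σ.reg 7 + b := by rw [hτ]; simp
      have e10 : τ.reg 10 = σ.reg 10 + σ.reg 10 := by rw [hτ]; simp
      have e11 : τ.reg 11 = m := by rw [hτ]; simp [h11]
      have e12 : τ.reg 12 = m - τ.reg 10 := by rw [hτ]; simp [h11]
      have := ih τ ?_ ?_ e11 e12 ?_ ?_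
      · rwa [e7] at this
      · rw [hτ]
        exact ((((hf.setReg (by omega)).setReg le_rfl).setReg le_rfl).setReg (by omega)).setReg
          (by omega)
      · rw [hτ]; exact ha
      · rw [e10]; rw [pow_succ] at hd; linarith
      · intro i hi
        have := hd' (i + 1) (by omega)
        rw [e10]; rw [pow_succ] at this; linarith
    rw [show 10 * (d + 1) + 1 + T' = (7 + (10 * d + 1 + T')) + 2 + 1 by ring, hitProb_while h0,
      sampleBody, hitProb_flip_seq, ← sampleBody, sum_range_two_pow_succ]
    have h1 := key 0
    have h2 := key 1
    rw [Nat.add_zero] at h1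
    refine le_trans (le_of_eq ?_) (div_le_div_of_nonneg_right (add_le_add h1 h2) zero_le_two)
    rw [pow_succ]
    field_simp

theorem qnt_sampleP (hσ : Env G σ) {d : ℕ} (hd : 2 * n ≤ 2 ^ d) (hd' : ∀ i < d, 2 ^ i < 2 * n)
    {q : ℝ} (B : Finset ℕ) (hB : B ⊆ Finset.range (2 ^ d)) (hq : q * 2 ^ d ≤ B.card) :
    Qnt sampleP σ (10 * d + 9) q (fun σ' => Frame 7 σ σ' ∧ σ'.arr = σ.arr)
      fun σ' => σ'.reg 7 ∈ B := by
  have e0 := hσ.reg_zero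
  refine Qnt.step_seq (fun _ => rfl) (Qnt.step_seq (fun _ => rfl) (Qnt.step_seq (fun _ => rfl)
    (Qnt.step_seq (fun _ => rfl) ?_)))
  intro k S T' a b hab ha hb
  refine le_trans ?_ (hitProb_sampleLoop k S T' (fun x => a + if x ∈ B then b - a else 0)
    (σ₀ := σ) (m := 2 * n) (d := d) ?_ _ ?_ rfl ?_ ?_ ?_ ?_)
  · have h1 : ∑ y ∈ Finset.range (2 ^ d), (if y ∈ B then b - a else 0) = B.card * (b - a) := by
      rw [← Finset.sum_filter, Finset.sum_const, nsmul_eq_mul,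
        Finset.filter_mem_eq_inter, Finset.inter_eq_right.2 hB]
    simp only [Mem.setReg_reg]
    simp only [show (7 : ℕ) ≠ 12 by omega, show (7 : ℕ) ≠ 11 by omega, show (7 : ℕ) ≠ 10 by omega,
      if_false, if_true, zero_mul, zero_add]
    rw [Finset.sum_add_distrib, h1, Finset.sum_const, Finset.card_range, nsmul_eq_mul,
      le_div_iff₀ (by positivity)]
    push_cast
    nlinarith [mul_le_mul_of_nonneg_right hq (sub_nonneg.2 hab)]
  · intro x σ' h1 h2 h3
    split_ifs with hx
    · rw [add_sub_cancel]
      exact hb σ' ⟨h1, h2⟩ (by subst h3; exact hx)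
    · rw [add_zero]
      exact ha σ' ⟨h1, h2⟩
  · exact ((((Frame.refl _ _).setReg le_rfl).setReg (by omega)).setReg (by omega)).setReg
      (by omega)
  · simp [e0, two_mul]
  · simp [e0, two_mul]
  · simpa using hd
  · simpa using hd'

end Sampling

section Round

variable {n : ℕ} {G : SimpleGraph (Fin n)} [DecidableRel G.Adj] {σ : Mem}

/-- The vertices of `G` that have at least `Δ / k` neighbours outside `W`. -/
def heavy (G : SimpleGraph (Fin n)) [DecidableRel G.Adj] (k : ℕ) (W : Finset (Fin n)) :
    Finset (Fin n) := Finset.univ.filter fun v => G.maxDegree ≤ k * rdeg G W v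

/-- Add to the set in array `2` the neighbours of the vertex in register `7`. -/
def nbrP : Prog := forN 10 (.seq (.load 11 2 10) (.seq (adjP 7 10)
  (.seq (.add 11 11 32) (.store 2 10 11))))

theorem tri_nbrP (hσ : Env G σ) {u : Fin n} (hu : σ.reg 7 = u) :
    Tri nbrP σ (n * (4 * n + 17) + 3) fun σ' => Frame 10 σ σ' ∧ (∀ b ≠ 2, σ'.arr b = σ.arr b) ∧
      arrSet n (σ'.arr 2) = arrSet n (σ.arr 2) ∪ G.neighborFinset u := by
  refine (Tri.forN (G := G) (Tb := 4 * n + 14) (I := fun j τ => Frame 10 σ τ ∧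
    (∀ b ≠ 2, τ.arr b = σ.arr b) ∧ ∀ v : Fin n,
      τ.arr 2 v = σ.arr 2 v + if j ≤ v ∧ G.Adj u v then 1 else 0) hσ ?_ ?_ ?_).weaken
    (by ring_nf; omega) fun τ h => ⟨h.1, h.2.1, ?_⟩
  · refine ⟨(Frame.refl _ _).setReg (by omega), fun _ _ => rfl, fun v => ?_⟩
    simp
  · rintro j τ ⟨h1, -⟩
    rw [h1 1 (by omega), hσ.reg_one]
  · rintro j τ hj ⟨h1, h2, h3⟩ hc
    have hE : Env G τ := hσ.of_frame h1 (by omega) (h2 0 (by omega))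
    refine Tri.load_seq (Tri.seq (tri_adjP ((hE.setReg (by omega)).setReg (by omega))
      (by omega : 7 < 30) (rv := 10) (u := u) (v := ⟨j, hj⟩) (by simp [h1 7 (by omega), hu])
      (by simp)) (T₂ := 3) ?_)
    rintro τ' ⟨k1, k2, k3⟩
    have k10 : τ'.reg 10 = j := by rw [k1 10 (by omega)]; simp
    have k11 : τ'.reg 11 = τ.arr 2 j := by rw [k1 11 (by omega)]; simp
    refine Tri.add_seq (Tri.store ⟨⟨((h1.trans (((k1.mono (by omega)).setReg_left
      (by omega)).setReg_left le_rfl)).setReg (by omega)).setArr, fun b hb => ?_, fun v => ?_⟩,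
      by simp [k10]⟩)
    · ext i; simp [hb, k2, h2 b hb]
    · have hvj : (v : ℕ) = j → v = ⟨j, hj⟩ := fun h => Fin.ext h
      have h3v := h3 v
      simp only [Mem.setArr_arr, Mem.setReg_reg, Mem.setReg_arr, k2, k10, k11, k3]
      by_cases hv : (v : ℕ) = j
      · have := hvj hv; subst this
        simp [h3v]
      · simp only [show (10 : ℕ) ≠ 11 by omega, if_false, hv, and_false, h3v]
        have : j + 1 ≤ (v : ℕ) ↔ j ≤ (v : ℕ) := by omega
        simp [this]
  · ext v
    have := h.2.2 v
    simp only [Finset.mem_union, mem_arrSet, SimpleGraph.mem_neighborFinset, this]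
    by_cases hv : G.Adj u v <;> simp [hv]

/-- Mark in array `4` the vertices that have at least `Δ / k` neighbours outside the set in
array `2`. -/
def heavyP (k : ℕ) : Prog := forN 10 (.seq (degP 10) (.seq (.add 13 3 2) (.seq (.const 12 k)
  (.seq (down 12 (.sub 13 13 21)) (.ite 13 (.store 4 10 2) (.store 4 10 1))))))

theorem tri_heavyP (hσ : Env G σ) (h3 : σ.reg 3 = G.maxDegree) (k : ℕ) :
    Tri (heavyP k) σ (n * (n * (4 * n + 17) + 4 * k + 17) + 3) fun σ' => Frame 10 σ σ' ∧
      (∀ b ≠ 4, σ'.arr b = σ.arr b) ∧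
      arrSet n (σ'.arr 4) = heavy G k (arrSet n (σ.arr 2)) := by
  set W := arrSet n (σ.arr 2) with hW
  refine (Tri.forN (G := G) (Tb := n * (4 * n + 17) + 4 * k + 14) (I := fun j τ => Frame 10 σ τ ∧
    (∀ b ≠ 4, τ.arr b = σ.arr b) ∧ ∀ v : Fin n, j ≤ v →
      (τ.arr 4 v ≠ 0 ↔ v ∈ heavy G k W)) hσ ?_ ?_ ?_).weaken
    (by ring_nf; omega) fun τ h => ⟨h.1, h.2.1, ?_⟩
  · exact ⟨(Frame.refl _ _).setReg (by omega), fun _ _ => rfl, fun v _ => by omega⟩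
  · rintro j τ ⟨h1, -⟩
    rw [h1 1 (by omega), hσ.reg_one]
  · rintro j τ hj ⟨h1, h2, h4⟩ hc
    have hE : Env G τ := hσ.of_frame h1 (by omega) (h2 0 (by omega))
    refine (Tri.seq (tri_degP (hE.setReg (by omega)) (by omega : 10 < 20) (u := ⟨j, hj⟩) (by simp))
      (T₂ := 4 * k + 8) ?_).weaken (by omega) fun _ h => h
    rintro τ' ⟨k1, k2, k3⟩
    have hF : Frame 10 σ τ' := h1.trans ((k1.mono (by omega)).setReg_left le_rfl)
    have k10 : τ'.reg 10 = j := by rw [k1 10 (by omega)]; simp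
    have k21 : τ'.reg 21 = rdeg G W ⟨j, hj⟩ := by rw [k3]; simp [h2]; rfl
    have kone : τ'.reg 1 = 1 := by rw [hF 1 (by omega), hσ.reg_one]
    have ktwo : τ'.reg 2 = 0 := by rw [hF 2 (by omega), hσ.reg_two]
    have kthree : τ'.reg 3 = G.maxDegree := by rw [hF 3 (by omega), h3]
    refine Tri.add_seq (Tri.const_seq (Tri.seq (Tri.down (Tb := 1) (I := fun i τ₁ =>
      Frame 12 τ' τ₁ ∧ τ₁.arr = τ'.arr ∧ τ₁.reg 21 = τ'.reg 21 ∧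
      τ₁.reg 13 = G.maxDegree - (k - i) * rdeg G W ⟨j, hj⟩ ∧ i ≤ k) ?_ ?_ k _ ?_ ?_)
      (T₂ := 2) ?_) |>.weaken (by omega) fun _ h => h)
    · rintro i τ₁ ⟨l1, -⟩
      rw [l1 1 (by omega), kone]
    · rintro i τ₁ ⟨l1, l2, l21, l13, li⟩ -
      refine Tri.sub ⟨⟨(l1.setReg le_rfl).setReg (by omega), l2, by simp [l21], ?_, by omega⟩,
        by simp⟩
      simp only [Mem.setReg_reg, if_true, show (13 : ℕ) ≠ 12 by omega, show (21 : ℕ) ≠ 12 by omega,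
        if_false, l13, l21, k21]
      rw [show k - i = k - (i + 1) + 1 by omega, Nat.succ_mul, Nat.sub_sub]
    · exact ⟨((Frame.refl _ _).setReg (by omega)).setReg le_rfl, rfl, by simp,
        by simp [kthree, ktwo], le_rfl⟩
    · simp
    · rintro τ₁ ⟨l1, l2, l21, l13, li⟩
      have m10 : τ₁.reg 10 = j := by rw [l1 10 (by omega), k10]
      have m1 : τ₁.reg 1 = 1 := by rw [l1 1 (by omega), kone]
      have m2 : τ₁.reg 2 = 0 := by rw [l1 2 (by omega), ktwo]
      have hF₁ : Frame 10 σ τ₁ := hF.trans (l1.mono (by omega))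
      have harr : τ₁.arr = τ.arr := by rw [l2, k2]; rfl
      have hheavy : (⟨j, hj⟩ : Fin n) ∈ heavy G k W ↔ τ₁.reg 13 = 0 := by
        rw [l13, heavy, Finset.mem_filter, Nat.sub_eq_zero_iff_le]
        simp
      have hpost : ∀ x : ℕ, ((⟨j, hj⟩ : Fin n) ∈ heavy G k W ↔ x ≠ 0) →
          ((Frame 10 σ (τ₁.setArr 4 j x) ∧ (∀ b ≠ 4, (τ₁.setArr 4 j x).arr b = σ.arr b) ∧
            ∀ v : Fin n, j ≤ v → ((τ₁.setArr 4 j x).arr 4 v ≠ 0 ↔ v ∈ heavy G k W)) ∧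
            (τ₁.setArr 4 j x).reg 10 = j) := by
        refine fun x hx => ⟨⟨hF₁.setArr, fun b hb => ?_, fun v hv => ?_⟩, m10⟩
        · ext i; simp [hb, harr, h2 b hb]
        · by_cases hvj : (v : ℕ) = j
          · have : v = ⟨j, hj⟩ := Fin.ext hvj
            subst this
            simp [hx]
          · simpa [hvj, harr] using h4 v (by omega)
      refine Tri.ite (fun hx => Tri.store ?_) fun hx => Tri.store ?_
      · rw [m10, m2]
        exact hpost 0 (by rw [hheavy]; simpa using hx)
      · rw [m10, m1]
        exact hpost 1 (by rw [hheavy]; simpa using hx)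
  · ext v
    rw [mem_arrSet]
    exact h.2.2 v (by omega)

/-- Add the set in array `4` to the set in array `2`. -/
def orP : Prog := forN 10 (.seq (.load 11 2 10) (.seq (.load 12 4 10)
  (.seq (.add 11 11 12) (.store 2 10 11))))

theorem tri_orP (hσ : Env G σ) :
    Tri orP σ (n * 10 + 3) fun σ' => Frame 10 σ σ' ∧ (∀ b ≠ 2, σ'.arr b = σ.arr b) ∧
      arrSet n (σ'.arr 2) = arrSet n (σ.arr 2) ∪ arrSet n (σ.arr 4) := by
  refine (Tri.forN (G := G) (Tb := 7) (I := fun j τ => Frame 10 σ τ ∧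
    (∀ b ≠ 2, τ.arr b = σ.arr b) ∧ ∀ v : Fin n,
      τ.arr 2 v = σ.arr 2 v + if j ≤ v then σ.arr 4 v else 0) hσ ?_ ?_ ?_).weaken
    (by ring_nf; omega) fun τ h => ⟨h.1, h.2.1, ?_⟩
  · refine ⟨(Frame.refl _ _).setReg (by omega), fun _ _ => rfl, fun v => ?_⟩
    simp
  · rintro j τ ⟨h1, -⟩
    rw [h1 1 (by omega), hσ.reg_one]
  · rintro j τ hj ⟨h1, h2, h3⟩ hc
    refine Tri.load_seq (Tri.load_seq (Tri.add_seq (Tri.store ⟨⟨((((h1.setReg (by omega)).setReg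
      (by omega)).setReg (by omega)).setReg (by omega)).setArr, fun b hb => ?_, fun v => ?_⟩,
      by simp⟩)))
    · ext i; simp [hb, h2 b hb]
    · have h3v := h3 v
      have h4 := h2 4 (by omega)
      by_cases hv : (v : ℕ) = j
      · subst hv
        simp [h3v, h4]
      · have : j + 1 ≤ (v : ℕ) ↔ j ≤ (v : ℕ) := by omega
        simp [h3v, hv, this]
  · ext v
    have := h.2.2 v
    simp only [Finset.mem_union, mem_arrSet, this]
    simp
    omega

/-- Enlarge the set in array `2`: if register `7` holds a vertex, by the neighbours of that vertex,
otherwise by all the heavy vertices. -/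
def growP (k : ℕ) : Prog := .seq (.sub 8 0 7) (.ite 8 nbrP (.seq (heavyP k) orP))

theorem tri_growP (hσ : Env G σ) (h3 : σ.reg 3 = G.maxDegree) (k : ℕ) :
    Tri (growP k) σ (n * (n * (4 * n + 17) + 4 * k + 27) + 10) fun σ' => Frame 7 σ σ' ∧
      (∀ b ≠ 2, b ≠ 4 → σ'.arr b = σ.arr b) ∧
      (∀ u : Fin n, σ.reg 7 = u →
        arrSet n (σ'.arr 2) = arrSet n (σ.arr 2) ∪ G.neighborFinset u) ∧
      (n ≤ σ.reg 7 →
        arrSet n (σ'.arr 2) = arrSet n (σ.arr 2) ∪ heavy G k (arrSet n (σ.arr 2))) := by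
  have hE : Env G (σ.setReg 8 (σ.reg 0 - σ.reg 7)) := hσ.setReg (by omega)
  refine (Tri.sub_seq (Tri.ite (T := n * (n * (4 * n + 17) + 4 * k + 27) + 7) (fun h => ?_)
    fun h => ?_)).weaken (by omega) fun _ h => h
  · simp only [Mem.setReg_reg, if_true, hσ.reg_zero] at h
    refine (tri_nbrP hE (u := ⟨σ.reg 7, by omega⟩) (by simp)).weaken ?_ ?_
    · nlinarith [Nat.le_mul_self n]
    · rintro τ ⟨k1, k2, k3⟩
      refine ⟨(k1.mono (by omega)).setReg_left (by omega), fun b hb _ => k2 b hb, fun u hu => ?_,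
        fun h' => by omega⟩
      rw [k3, show (⟨σ.reg 7, by omega⟩ : Fin n) = u from Fin.ext hu]
      rfl
  · simp only [Mem.setReg_reg, if_true, hσ.reg_zero] at h
    refine (Tri.seq (tri_heavyP hE (by simpa using h3) k) (T₂ := n * 10 + 3) ?_).weaken
      (by ring_nf; omega) fun _ h => h
    rintro τ ⟨k1, k2, k3⟩
    refine (tri_orP (hE.of_frame k1 (by omega) (k2 0 (by omega)))).weaken le_rfl ?_
    rintro τ' ⟨l1, l2, l3⟩
    refine ⟨((k1.trans l1).mono (by omega)).setReg_left (by omega), fun b hb hb' => ?_,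
      fun u hu => by have := u.2; omega, fun _ => ?_⟩
    · rw [l2 b hb, k2 b hb']; rfl
    · rw [l3, k3, k2 2 (by omega)]; rfl

end Round

/-! ### Initialization -/

section Initialization

variable {n : ℕ} {G : SimpleGraph (Fin n)} [DecidableRel G.Adj] {σ : Mem}

theorem rdeg_empty (u : Fin n) : rdeg G ∅ u = G.degree u := by
  rw [rdeg, ← SimpleGraph.card_neighborFinset_eq_degree]
  congr 1
  ext v
  simp

/-- Register `3` receives the maximum degree (array `2` represents the empty set here). -/
def maxDegP : Prog := .seq (.const 3 0) (forN 10 (.seq (degP 10) (.seq (.sub 11 21 3)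
  (.add 3 3 11))))

theorem tri_maxDegP (hσ : Env G σ) (h2 : arrSet n (σ.arr 2) = ∅) :
    Tri maxDegP σ (n * (n * (4 * n + 17) + 12) + 5) fun σ' => Frame 3 σ σ' ∧ σ'.arr = σ.arr ∧
      σ'.reg 3 = G.maxDegree := by
  refine (Tri.const_seq (Tri.forN (G := G) (Tb := n * (4 * n + 17) + 9) (I := fun j τ =>
    Frame 3 σ τ ∧ τ.arr = σ.arr ∧ τ.reg 3 ≤ G.maxDegree ∧ ∀ v : Fin n, j ≤ v → G.degree v ≤ τ.reg 3)
    (hσ.setReg le_rfl) ?_ ?_ ?_)).weaken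
    (by ring_nf; omega) fun τ h => ⟨h.1, h.2.1, h.2.2.1.antisymm ?_⟩
  · exact ⟨((Frame.refl _ _).setReg le_rfl).setReg (by omega), rfl, by simp, fun v _ => by omega⟩
  · rintro j τ ⟨h1, -⟩
    rw [h1 1 (by omega), hσ.reg_one]
  · rintro j τ hj ⟨h1, ha, h3, h4⟩ hc
    have hE : Env G τ := hσ.of_frame h1 (by omega) (by rw [ha])
    refine (Tri.seq (tri_degP (hE.setReg (by omega)) (by omega : 10 < 20) (u := ⟨j, hj⟩) (by simp))
      (T₂ := 3) ?_).weaken (by omega) fun _ h => h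
    rintro τ' ⟨k1, k2, k3⟩
    rw [Mem.setReg_arr, ha, h2, rdeg_empty] at k3
    have k10 : τ'.reg 10 = j := by rw [k1 10 (by omega)]; simp
    have k3' : τ'.reg 3 = τ.reg 3 := by rw [k1 3 (by omega)]; simp
    have hm := G.degree_le_maxDegree ⟨j, hj⟩
    refine Tri.sub_seq (Tri.add ⟨⟨((h1.trans ((k1.mono (by omega)).setReg_left
      (by omega))).setReg (by omega)).setReg le_rfl, by simp [k2, ha], ?_, fun v hv => ?_⟩,
      by simp [k10]⟩)
    · simp [k3, k3']; omega
    · by_cases hvj : (v : ℕ) = j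
      · have : v = ⟨j, hj⟩ := Fin.ext hvj
        subst this
        simp [k3, k3']; omega
      · have := h4 v (by omega)
        simp [k3, k3']; omega
  · exact G.maxDegree_le_of_forall_degree_le _ fun v => h.2.2.2 v (by omega)

/-- Register `4` receives `1 + ⌈k n / Δ⌉`, the number of rounds of a trial. -/
def roundsP (k : ℕ) : Prog := .seq (.const 4 1) (.seq (.const 10 0) (.seq (.const 11 k)
  (.seq (down 11 (.add 10 10 0)) (.while 10 (.seq (.sub 10 10 3) (.add 4 4 1))))))

theorem tri_divLoop {σ₀ : Mem} {D m r : ℕ} (hone : σ₀.reg 1 = 1) (h3 : σ₀.reg 3 = D) (σ : Mem)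
    (hf : Frame 4 σ₀ σ) (ha : σ.arr = σ₀.arr) (h4 : σ.reg 4 = r)
    (h10 : σ.reg 10 ≤ m * D) (h10' : m * D < σ.reg 10 + D) :
    Tri (.while 10 (.seq (.sub 10 10 3) (.add 4 4 1))) σ (4 * m + 1) fun σ' =>
      Frame 4 σ₀ σ' ∧ σ'.arr = σ₀.arr ∧ σ'.reg 4 = r + m := by
  induction m generalizing σ r with
  | zero => exact Tri.while_zero (by omega) ⟨hf, ha, h4⟩
  | succ m ih =>
    rw [Nat.succ_mul] at h10 h10'
    refine (Tri.while_succ (by omega) (Tri.sub_seq (Tri.add (Q := fun τ => τ = _) rfl))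
      (T₂ := 4 * m + 1) ?_).weaken (by omega) fun _ h => h
    rintro τ rfl
    refine (ih (r := r + 1) _ ((hf.setReg (by omega)).setReg le_rfl) (by simpa using ha) ?_ ?_
      ?_).weaken le_rfl fun τ h => ⟨h.1, h.2.1, by rw [h.2.2]; ring⟩
    · simp [h4, hf 1 (by omega), hone]
    · simp [hf 3 (by omega), h3]; omega
    · have : m = 0 ∨ D ≤ m * D := by
        rcases m with _ | m
        · exact .inl rfl
        · exact .inr (by rw [Nat.succ_mul]; omega)
      simp [hf 3 (by omega), h3]
      rcases this with rfl | h
      · omega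
      · omega

theorem tri_roundsP (hσ : Env G σ) {D : ℕ} (h3 : σ.reg 3 = D) (k : ℕ) {m : ℕ}
    (hm : k * n ≤ m * D) (hm' : m * D < k * n + D) :
    Tri (roundsP k) σ (4 * k + 4 * m + 9) fun σ' => Frame 4 σ σ' ∧ σ'.arr = σ.arr ∧
      σ'.reg 4 = m + 1 := by
  refine (Tri.const_seq (Tri.const_seq (Tri.const_seq (Tri.seq (Tri.down (Tb := 1) (I := fun j τ =>
    Frame 4 σ τ ∧ τ.arr = σ.arr ∧ τ.reg 4 = 1 ∧ τ.reg 10 + j * n = k * n) ?_ ?_ k _ ?_ ?_)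
    (T₂ := 4 * m + 1) ?_)))).weaken (by omega) fun _ h => h
  · rintro j τ ⟨h1, -⟩
    rw [h1 1 (by omega), hσ.reg_one]
  · rintro j τ ⟨h1, h2, h4, h10⟩ -
    refine Tri.add ⟨⟨(h1.setReg (by omega)).setReg (by omega), h2, by simp [h4], ?_⟩, by simp⟩
    rw [Nat.succ_mul] at h10
    simp [h1 0 (by omega), hσ.reg_zero]
    omega
  · exact ⟨(((Frame.refl _ _).setReg le_rfl).setReg (by omega)).setReg (by omega), rfl,
      by simp, by simp⟩
  · simp
  · rintro τ ⟨h1, h2, h4, h10⟩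
    have e : τ.reg 10 = k * n := by omega
    exact (tri_divLoop hσ.reg_one h3 τ h1 h2 h4 (by rw [e]; exact hm)
      (by rw [e]; exact hm')).weaken le_rfl fun τ h => ⟨h.1, h.2.1, by rw [h.2.2]; ring⟩

/-- Register `5` receives the number of trials, `n * 2 ^ (s * R)` for `R` in register `4`. -/
def trialsP (s : ℕ) : Prog := .seq (.add 5 0 2) (.seq (.add 10 4 2)
  (down 10 (.seq (.const 11 s) (down 11 (.add 5 5 5)))))

theorem tri_trialsP (hσ : Env G σ) {R : ℕ} (h4 : σ.reg 4 = R) (s : ℕ) :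
    Tri (trialsP s) σ (R * (4 * s + 6) + 5) fun σ' => Frame 5 σ σ' ∧ σ'.arr = σ.arr ∧
      σ'.reg 5 = n * 2 ^ (s * R) := by
  refine (Tri.add_seq (Tri.add_seq (Tri.down (Tb := 4 * s + 3) (I := fun j τ =>
    Frame 5 σ τ ∧ τ.arr = σ.arr ∧ τ.reg 5 * 2 ^ (s * j) = n * 2 ^ (s * R)) ?_ ?_ R _ ?_ ?_))).weaken
    (by ring_nf; omega) fun τ h => ⟨h.1, h.2.1, by simpa using h.2.2⟩
  · rintro j τ ⟨h1, -⟩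
    rw [h1 1 (by omega), hσ.reg_one]
  · rintro j τ ⟨h1, h2, h5⟩ hc
    refine (Tri.const_seq (Tri.down (Tb := 1) (I := fun i τ => Frame 5 σ τ ∧ τ.arr = σ.arr ∧
      τ.reg 10 = j ∧ τ.reg 5 * 2 ^ (s * j + i) = n * 2 ^ (s * R)) ?_ ?_ s _ ?_ ?_)).weaken
      (by omega) fun τ h => ⟨⟨h.1, h.2.1, by simpa using h.2.2.2⟩, h.2.2.1⟩
    · rintro i τ ⟨h1, -⟩
      rw [h1 1 (by omega), hσ.reg_one]
    · rintro i τ ⟨k1, k2, k10, k5⟩ -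
      refine Tri.add ⟨⟨(k1.setReg (by omega)).setReg le_rfl, k2, by simp [k10], ?_⟩, by simp⟩
      rw [← k5]
      simp
      ring
    · exact ⟨(h1.setReg (by omega)).setReg (by omega), h2, by simp,
        by rw [← h5, Nat.mul_succ]; simp⟩
    · simp
  · refine ⟨((Frame.refl _ _).setReg le_rfl).setReg (by omega), rfl, ?_⟩
    simp [hσ.reg_zero, hσ.reg_two]
  · simp [h4, hσ.reg_two]

/-- Set up the constants, the numbers of rounds and trials, and the trivial vertex cover in
array `1`. -/
def initP (k s : ℕ) : Prog := .seq (.const 1 1) (.seq (fillP 1 1) (.seq maxDegP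
  (.seq (roundsP k) (trialsP s))))

theorem env_graphInput : Env G ((graphInput G).setReg 1 1) := by
  refine ⟨by simp [graphInput], by simp, by simp [graphInput], fun u v => ?_⟩
  have h : (∃ u' v' : Fin n, G.Adj u' v' ∧ (u : ℕ) * n + v = (u' : ℕ) * n + v') ↔ G.Adj u v := by
    refine ⟨?_, fun h => ⟨u, v, h, rfl⟩⟩
    rintro ⟨u', v', h, e⟩
    have hn : 0 < n := u.pos
    have e1 : (u : ℕ) = u' := by
      have := congrArg (· / n) e
      simpa [Nat.add_div_of_dvd_right, Nat.mul_div_cancel _ hn, Nat.div_eq_of_lt] using this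
    have e2 : (v : ℕ) = v' := by rw [e1] at e; omega
    rw [Fin.ext e1, Fin.ext e2]
    exact h
  simp [graphInput, h]

theorem tri_initP (k s : ℕ) {m : ℕ}
    (hm : k * n ≤ m * G.maxDegree) (hm' : m * G.maxDegree < k * n + G.maxDegree) :
    Tri (initP k s) (graphInput G)
      (n * (n * (4 * n + 17) + 16) + 4 * k + 4 * m + (m + 1) * (4 * s + 6) + 27) fun σ =>
      Env G σ ∧ σ.reg 3 = G.maxDegree ∧ σ.reg 4 = m + 1 ∧ σ.reg 5 = n * 2 ^ (s * (m + 1)) ∧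
        arrSet n (σ.arr 1) = Finset.univ := by
  refine (Tri.const_seq (Tri.seq (tri_fillP env_graphInput (by omega : 1 < 10) (a := 1))
    (T₂ := n * (n * (4 * n + 17) + 12) + 4 * k + 4 * m + (m + 1) * (4 * s + 6) + 21)
    ?_)).weaken (by ring_nf; omega) fun _ h => h
  rintro σ₁ ⟨f1, f2, f3⟩
  have hσ₁ := env_graphInput.of_frame f1 (by omega) (f2 0 (by omega))
  refine (Tri.seq (tri_maxDegP hσ₁ ?_) (T₂ := 4 * k + 4 * m + (m + 1) * (4 * s + 6) + 15)
    ?_).weaken (by omega) fun _ h => h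
  · ext v
    simp [mem_arrSet, f2 2 (by omega), graphInput]
  rintro σ₂ ⟨g1, g2, g3⟩
  have hσ₂ := hσ₁.of_frame g1 (by omega) (by rw [g2])
  refine (Tri.seq (tri_roundsP hσ₂ g3 k hm hm') (T₂ := (m + 1) * (4 * s + 6) + 5)
    ?_).weaken (by omega) fun _ h => h
  rintro σ₃ ⟨l1, l2, l3⟩
  have hσ₃ := hσ₂.of_frame l1 (by omega) (by rw [l2])
  refine (tri_trialsP hσ₃ l3 s).weaken le_rfl ?_
  rintro σ₄ ⟨p1, p2, p3⟩
  refine ⟨hσ₃.of_frame p1 (by omega) (by rw [p2]), ?_, ?_, p3, ?_⟩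
  · rw [p1 3 (by omega), l1 3 (by omega), g3]
  · rw [p1 4 (by omega), l3]
  · ext v
    simp [mem_arrSet, p2, l2, g2, f3 v v.2]

end Initialization

/-! ### Combinatorics of partial covers -/

section Combinatorics

variable {n : ℕ} {G : SimpleGraph (Fin n)} [DecidableRel G.Adj]

theorem rdeg_le_degree (W : Finset (Fin n)) (u : Fin n) : rdeg G W u ≤ G.degree u := by
  rw [rdeg, ← SimpleGraph.card_neighborFinset_eq_degree]
  exact Finset.card_le_card fun v => by simp +contextual

theorem rdeg_eq_card_sdiff (W : Finset (Fin n)) (u : Fin n) :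
    rdeg G W u = (G.neighborFinset u \ W).card := by
  rw [rdeg]; congr 1; ext v; simp

/-- Each edge has an end in `W`, and is then counted at most twice by the degrees of `W`, or it is
an edge of `G - W`. -/
theorem sum_degree_le (W : Finset (Fin n)) :
    ∑ v, G.degree v ≤ 2 * W.card * G.maxDegree + ∑ v ∈ Wᶜ, rdeg G W v := by
  have h1 : ∀ v, G.degree v = rdeg G W v + (W.filter fun w => G.Adj v w).card := fun v => by
    rw [rdeg_eq_card_sdiff, ← SimpleGraph.card_neighborFinset_eq_degree,
      ← Finset.card_sdiff_add_card_inter _ W]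
    congr 2
    ext w
    simp [and_comm]
  have h2 : ∑ v ∈ W, G.degree v ≤ W.card * G.maxDegree := by
    simpa using Finset.sum_le_card_nsmul W _ _ fun v _ => G.degree_le_maxDegree v
  have h3 : ∑ v, (W.filter fun w => G.Adj v w).card = ∑ w ∈ W, G.degree w := by
    simp only [← SimpleGraph.card_neighborFinset_eq_degree, SimpleGraph.neighborFinset_eq_filter,
      Finset.card_filter]
    rw [Finset.sum_comm]
    simp only [G.adj_comm]
  have h4 : ∑ v ∈ Wᶜ, (W.filter fun w => G.Adj v w).card ≤ ∑ w ∈ W, G.degree w :=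
    h3 ▸ Finset.sum_le_sum_of_subset (Finset.subset_univ _)
  have h5 : ∑ v ∈ Wᶜ, G.degree v = ∑ v ∈ Wᶜ, rdeg G W v +
      ∑ v ∈ Wᶜ, (W.filter fun w => G.Adj v w).card := by
    rw [← Finset.sum_add_distrib]; exact Finset.sum_congr rfl fun v _ => h1 v
  rw [← Finset.sum_add_sum_compl W]
  linarith

theorem sum_degree_le_of_isVertexCover {O : Finset (Fin n)}
    (hO : G.IsVertexCover (O : Set (Fin n))) : ∑ v, G.degree v ≤ 2 * O.card * G.maxDegree := by
  refine (sum_degree_le O).trans (le_of_eq ?_)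
  rw [Finset.sum_eq_zero, Nat.add_zero]
  intro v hv
  rw [Finset.mem_compl] at hv
  rw [rdeg, Finset.card_eq_zero, Finset.filter_eq_empty_iff]
  rintro w - ⟨h1, h2⟩
  rcases hO h1 with h | h
  · exact hv (by simpa using h)
  · exact h2 (by simpa using h)

/-- If there are few heavy vertices outside `W`, then `W` covers almost all edges, so that it
has almost the size of half the degree sum over `Δ`. -/
theorem mul_sum_degree_le {k : ℕ} {W : Finset (Fin n)} (h : k * (heavy G k W \ W).card < n) :
    k * ∑ v, G.degree v ≤ 2 * k * W.card * G.maxDegree + 2 * n * G.maxDegree := by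
  have h1 : k * ∑ v ∈ Wᶜ, rdeg G W v ≤ 2 * n * G.maxDegree := by
    have hs : ∀ v ∈ Wᶜ, k * rdeg G W v ≤
        G.maxDegree + if v ∈ heavy G k W \ W then k * G.maxDegree else 0 := by
      intro v hv
      by_cases hh : v ∈ heavy G k W
      · rw [Finset.mem_compl] at hv
        rw [if_pos (by simp [hh, hv])]
        have := Nat.mul_le_mul_left k ((rdeg_le_degree W v).trans (G.degree_le_maxDegree v))
        omega
      · rw [heavy, Finset.mem_filter] at hh
        have : ¬ G.maxDegree ≤ k * rdeg G W v := fun h' => hh ⟨Finset.mem_univ _, h'⟩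
        omega
    rw [Finset.mul_sum]
    refine (Finset.sum_le_sum hs).trans ?_
    rw [Finset.sum_add_distrib, ← Finset.sum_filter]
    simp only [Finset.sum_const, smul_eq_mul]
    have c1 : (Wᶜ).card ≤ n := by simpa using Finset.card_le_univ (Wᶜ)
    have c2 : (Wᶜ.filter fun v => v ∈ heavy G k W \ W).card ≤ (heavy G k W \ W).card :=
      Finset.card_le_card fun v => by simp +contextual
    have c3 := Nat.mul_le_mul_right G.maxDegree c1
    have c4 := Nat.mul_le_mul_right G.maxDegree ((Nat.mul_le_mul_left k c2).trans h.le)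
    calc _ ≤ n * G.maxDegree + k * (Wᶜ.filter fun v => v ∈ heavy G k W \ W).card * G.maxDegree := by
          rw [← mul_assoc, mul_comm _ k]; omega
      _ ≤ _ := by rw [two_mul, Nat.add_mul]; omega
  have h2 := Nat.mul_le_mul_left k (sum_degree_le (G := G) W)
  rw [Nat.mul_add] at h2
  calc _ ≤ _ := h2
    _ ≤ _ := by
      rw [show k * (2 * W.card * G.maxDegree) = 2 * k * W.card * G.maxDegree by ring]
      omega

/-- The guarantee for a cover `C` built from a set `W` that covers almost all edges and lies, up to
a fraction `1 / k`, in the vertex cover `O`. With `γ` half the ratio of average to maximum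
degree, `C` has at most `n` and about `2 |O| - γ n` vertices; weighting these bounds by `γ` and `1`
eliminates `n`. If `γ` is small, `|C| ≤ 2 |O|` suffices. -/
theorem card_le_ratio {ε : ℝ} (hε : 0 < ε) {k : ℕ} (hk2 : 2 ≤ k) (hk : 6 ≤ k * ε ^ 2)
    (hΔ : 0 < G.maxDegree) {O W C : Finset (Fin n)} (hO : G.IsVertexCover (O : Set (Fin n)))
    (hC : C.card ≤ W.card + 2 * (O \ W).card) (hW : k * (W \ O).card ≤ W.card)
    (hout : k * (heavy G k W \ W).card < n) :
    (C.card : ℝ) ≤ (2 / (1 + G.avgDegree / (2 * (G.maxDegree : ℝ))) + ε) * O.card := by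
  have hn : (0 : ℝ) < n := by
    have : 0 < n := by omega
    exact_mod_cast this
  have hD : (0 : ℝ) < G.maxDegree := by exact_mod_cast hΔ
  have hk0 : (0 : ℝ) < k := by exact_mod_cast (by omega : 0 < k)
  set γ := G.avgDegree / (2 * (G.maxDegree : ℝ)) with hγ
  have hsum : (∑ v, (G.degree v : ℝ)) = 2 * (γ * n) * G.maxDegree := by
    rw [hγ, SimpleGraph.avgDegree]; field_simp
  have hγ0 : 0 ≤ γ := by
    rw [hγ, SimpleGraph.avgDegree]; positivity
  have h1 : k * (γ * n) ≤ k * W.card + n := by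
    have h : (k : ℝ) * ∑ v, (G.degree v : ℝ)
        ≤ 2 * k * W.card * G.maxDegree + 2 * n * G.maxDegree := by
      exact_mod_cast mul_sum_degree_le hout
    rw [hsum] at h
    nlinarith
  have h2 : γ * n ≤ O.card := by
    have h : ∑ v, (G.degree v : ℝ) ≤ 2 * O.card * G.maxDegree := by
      exact_mod_cast sum_degree_le_of_isVertexCover hO
    rw [hsum] at h
    nlinarith
  have e1 : ((O \ W).card : ℝ) + (O ∩ W).card = O.card := by
    exact_mod_cast Finset.card_sdiff_add_card_inter O W
  have e2 : ((W \ O).card : ℝ) + (O ∩ W).card = W.card := by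
    rw [Finset.inter_comm]; exact_mod_cast Finset.card_sdiff_add_card_inter W O
  have h3 : (C.card : ℝ) ≤ W.card + 2 * (O \ W).card := by exact_mod_cast hC
  have h4 : (k : ℝ) * (W \ O).card ≤ W.card := by exact_mod_cast hW
  have hWn : (W.card : ℝ) ≤ n := by exact_mod_cast (by simpa using Finset.card_le_univ W)
  have hCn : (C.card : ℝ) ≤ n := by exact_mod_cast (by simpa using Finset.card_le_univ C)
  have hO0 : (0 : ℝ) ≤ O.card := by positivity
  have hpos : 0 < 1 + γ := by linarith
  rcases le_total γ (ε / 2) with hs | hs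
  · have hC2 : (C.card : ℝ) ≤ 2 * O.card := by
      have : (2 : ℝ) ≤ k := by exact_mod_cast hk2
      have : (2 : ℝ) * (W \ O).card ≤ W.card := by nlinarith [Nat.cast_nonneg (α := ℝ) (W \ O).card]
      linarith
    have : 2 - 2 * γ ≤ 2 / (1 + γ) := by
      rw [le_div_iff₀ hpos]; nlinarith
    nlinarith
  · have h5 : (k : ℝ) * C.card ≤ k * (2 * O.card) - k * (γ * n) + 3 * n := by
      nlinarith
    have h6 : (k : ℝ) * ((1 + γ) * C.card) ≤ k * (2 * O.card) + 3 * n := by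
      nlinarith [mul_le_mul_of_nonneg_left hCn (mul_nonneg hk0.le hγ0)]
    have h7 : 3 * (n : ℝ) ≤ k * (ε * O.card) := by
      have a1 : ε / 2 * n ≤ O.card := (mul_le_mul_of_nonneg_right hs hn.le).trans h2
      have a2 : k * ε * (ε / 2 * n) ≤ k * ε * O.card :=
        mul_le_mul_of_nonneg_left a1 (by positivity)
      nlinarith [mul_le_mul_of_nonneg_right hk hn.le]
    have h8 : (1 + γ) * C.card ≤ 2 * O.card + ε * O.card := by
      nlinarith
    have h9 : (C.card : ℝ) ≤ (2 * O.card + ε * O.card) / (1 + γ) := by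
      rw [le_div_iff₀ hpos]; linarith
    refine h9.trans ?_
    have h10 : ε * O.card / (1 + γ) ≤ ε * O.card := div_le_self (by positivity) (by linarith)
    calc _ = 2 / (1 + γ) * O.card + ε * O.card / (1 + γ) := by ring
      _ ≤ _ := by linarith

theorem exists_isVertexCover_card_eq (G : SimpleGraph (Fin n)) :
    ∃ O : Finset (Fin n), G.IsVertexCover (O : Set (Fin n)) ∧
      O.card = G.vertexCoverNum.toNat := by
  classical
  obtain ⟨s, hs, hs'⟩ := G.vertexCoverNum_exists
  refine ⟨s.toFinset, by simpa using hs', ?_⟩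
  rw [← hs, Set.encard_eq_coe_toFinset_card]
  rfl

/-- The next set of a trial, as a function of the random number `x`: see `growP`. -/
def grow (G : SimpleGraph (Fin n)) [DecidableRel G.Adj] (k : ℕ) (W : Finset (Fin n)) (x : ℕ) :
    Finset (Fin n) :=
  if h : x < n then W ∪ G.neighborFinset ⟨x, h⟩ else W ∪ heavy G k W

/-- As long as many vertices outside `W` are heavy, a constant fraction of the random numbers makes
good progress: if many heavy vertices are not in the vertex cover `O`, each of them is a good
choice, as all its neighbours are in `O`; otherwise adding all the heavy vertices is, as few of
them are not in `O`. -/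
theorem exists_good_choices {k d : ℕ} (hk : 0 < k) (hd : 2 * n ≤ 2 ^ d) (hd' : 2 ^ d ≤ 4 * n)
    {O W : Finset (Fin n)} (hO : G.IsVertexCover (O : Set (Fin n)))
    (hW : k * (W \ O).card ≤ W.card) (hout : n ≤ k * (heavy G k W \ W).card) :
    ∃ B ⊆ Finset.range (2 ^ d), 2 ^ d ≤ 4 * k ^ 2 * B.card ∧ ∀ x ∈ B,
      k * W.card + G.maxDegree ≤ k * (grow G k W x).card ∧
      k * (grow G k W x \ O).card ≤ (grow G k W x).card := by
  set A := heavy G k W \ W with hA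
  by_cases hc : A.card ≤ k * (A \ O).card
  · refine ⟨(A \ O).map Fin.valEmbedding, ?_, ?_, ?_⟩
    · intro x hx
      obtain ⟨u, -, rfl⟩ := Finset.mem_map.1 hx
      have := u.2
      simp only [Fin.valEmbedding_apply, Finset.mem_range]
      omega
    · rw [Finset.card_map]
      nlinarith
    · intro x hx
      obtain ⟨u, hu, rfl⟩ := Finset.mem_map.1 hx
      rw [Finset.mem_sdiff] at hu
      have hN : G.neighborFinset u ⊆ O := by
        intro v hv
        rw [SimpleGraph.mem_neighborFinset] at hv
        rcases hO hv with h | h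
        · exact absurd (by simpa using h) hu.2
        · simpa using h
      have hg : grow G k W (Fin.valEmbedding u) = W ∪ G.neighborFinset u := by
        rw [grow, dif_pos (show Fin.valEmbedding u < n from u.2)]; rfl
      have hcard : (W ∪ G.neighborFinset u).card = W.card + rdeg G W u := by
        rw [Finset.union_comm, ← Finset.sdiff_union_self_eq_union,
          Finset.card_union_of_disjoint Finset.sdiff_disjoint, rdeg_eq_card_sdiff, Nat.add_comm]
      have hheavy : G.maxDegree ≤ k * rdeg G W u := by
        have := (Finset.mem_sdiff.1 hu.1).1
        rw [heavy, Finset.mem_filter] at this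
        exact this.2
      have hs : (W ∪ G.neighborFinset u) \ O = W \ O := by
        rw [Finset.union_sdiff_distrib, Finset.sdiff_eq_empty_iff_subset.2 hN, Finset.union_empty]
      rw [hg, hs, hcard]
      constructor
      · rw [Nat.mul_add]; omega
      · omega
  · refine ⟨Finset.range (2 ^ d) \ Finset.range n, Finset.sdiff_subset, ?_, ?_⟩
    · rw [Finset.card_sdiff_of_subset (Finset.range_subset_range.2 (by omega)), Finset.card_range,
        Finset.card_range]
      have : 1 ≤ k ^ 2 := Nat.one_le_pow _ _ hk
      have h : 2 ^ d ≤ 4 * (2 ^ d - n) := by omega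
      nlinarith
    · intro x hx
      have hx' : ¬ x < n := by simpa using (Finset.mem_sdiff.1 hx).2
      have hg : grow G k W x = W ∪ A := by
        rw [grow, dif_neg hx', hA, Finset.union_sdiff_self_eq_union]
      have hcard : (W ∪ A).card = W.card + A.card :=
        Finset.card_union_of_disjoint (by rw [hA]; exact Finset.disjoint_sdiff)
      have hs : ((W ∪ A) \ O).card ≤ (W \ O).card + (A \ O).card := by
        rw [Finset.union_sdiff_distrib]; exact Finset.card_union_le _ _
      rw [hg, hcard]
      have hn : 0 < n := by
        rcases Nat.eq_zero_or_pos n with rfl | h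
        · have := Nat.pow_pos (n := d) (show 0 < 2 by omega)
          omega
        · exact h
      have hΔ : G.maxDegree ≤ n := by
        have : Nonempty (Fin n) := ⟨⟨0, hn⟩⟩
        have := G.maxDegree_lt_card_verts
        simp at this; omega
      constructor
      · rw [Nat.mul_add]; omega
      · have := Nat.mul_le_mul_left k hs
        rw [Nat.mul_add] at this
        omega

end Combinatorics

/-! ### Correctness of the algorithm -/

section Main

theorem MatchedExt.isVertexCover {n : ℕ} {G : SimpleGraph (Fin n)} {W C : Finset (Fin n)}
    (h : MatchedExt G W C fun _ _ => True) :
    G.IsVertexCover (C : Set (Fin n)) := fun u v ha => by simpa using h.cover u v trivial ha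

variable {n : ℕ} {G : SimpleGraph (Fin n)} [DecidableRel G.Adj] {σ : Mem}

/-- The size of the set in array `1`. -/
def bestCard (n : ℕ) (σ : Mem) : ℕ := (arrSet n (σ.arr 1)).card

/-- What holds throughout the trials: the maximum degree and the number `R` of rounds are in their
registers, and array `1` contains a vertex cover. -/
structure MainInv (G : SimpleGraph (Fin n)) [DecidableRel G.Adj] (R : ℕ) (σ : Mem) : Prop where
  env : Env G σ
  reg_three : σ.reg 3 = G.maxDegree
  reg_four : σ.reg 4 = R
  cover : G.IsVertexCover (arrSet n (σ.arr 1) : Set (Fin n))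

theorem MainInv.of_frame {R b : ℕ} {σ' : Mem} (h : MainInv G R σ) (hf : Frame b σ σ') (hb : 5 ≤ b)
    (h0 : σ'.arr 0 = σ.arr 0) (hc : G.IsVertexCover (arrSet n (σ'.arr 1) : Set (Fin n))) :
    MainInv G R σ' :=
  ⟨h.env.of_frame hf (by omega) h0, by rw [hf 3 (by omega), h.reg_three],
    by rw [hf 4 (by omega), h.reg_four], hc⟩

theorem MainInv.setReg {R x v : ℕ} (h : MainInv G R σ) (hx : 5 ≤ x) : MainInv G R (σ.setReg x v) :=
  h.of_frame ((Frame.refl 5 σ).setReg hx) le_rfl rfl h.cover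

/-- Time bound for `matchP` and `updateP`. -/
def matchUpdateTime (n : ℕ) : ℕ := n * (n * (4 * n + 22) + 12) + 7 + (n * 20 + 20) + 1

theorem tri_match_update (hσ : Env G σ)
    (hc : G.IsVertexCover (arrSet n (σ.arr 1) : Set (Fin n))) :
    Tri (.seq matchP updateP) σ (matchUpdateTime n) fun σ' => Frame 10 σ σ' ∧
      σ'.arr 0 = σ.arr 0 ∧ σ'.arr 2 = σ.arr 2 ∧
      G.IsVertexCover (arrSet n (σ'.arr 1) : Set (Fin n)) ∧ bestCard n σ' ≤ bestCard n σ ∧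
      ∃ C, MatchedExt G (arrSet n (σ.arr 2)) C (fun _ _ => True) ∧ bestCard n σ' ≤ C.card := by
  refine Tri.seq (tri_matchP hσ) ?_
  rintro σ₁ ⟨f1, f2, f3⟩
  refine (tri_updateP (hσ.of_frame f1 (by omega) (f2 0 (by omega)))).weaken le_rfl ?_
  rintro σ₂ ⟨g1, g2, g3, g4, g5⟩
  rw [f2 1 (by omega)] at g3 g4
  refine ⟨f1.trans g1, by rw [g2 0 (by omega), f2 0 (by omega)],
    by rw [g2 2 (by omega), f2 2 (by omega)], ?_, g4, _, f3, g5⟩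
  rcases g3 with h | h
  · rw [h]; exact hc
  · rw [h]; exact f3.isVertexCover

/-- Time bound for `sampleP` and `growP k`; the sampling loop has at most `2 n` iterations. -/
def sampleGrowTime (k n : ℕ) : ℕ :=
  10 * (2 * n) + 9 + (n * (n * (4 * n + 17) + 4 * k + 27) + 10) + 1

theorem qnt_sample_grow (hσ : Env G σ) (h3 : σ.reg 3 = G.maxDegree) (k : ℕ) {q : ℝ} (B : Finset ℕ)
    (hB : B ⊆ Finset.range (2 ^ Nat.clog 2 (2 * n))) (hq : q * 2 ^ Nat.clog 2 (2 * n) ≤ B.card) :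
    Qnt (.seq sampleP (growP k)) σ (sampleGrowTime k n) q
      (fun σ' => Frame 7 σ σ' ∧ ∀ b ≠ 2, b ≠ 4 → σ'.arr b = σ.arr b)
      fun σ' => ∃ x ∈ B, arrSet n (σ'.arr 2) = grow G k (arrSet n (σ.arr 2)) x := by
  have hd : Nat.clog 2 (2 * n) ≤ 2 * n := Nat.clog_le_of_le_pow Nat.lt_two_pow_self.le
  have hs := (qnt_sampleP hσ (Nat.le_pow_clog one_lt_two (2 * n))
    (fun i hi => Nat.pow_lt_of_lt_clog hi) B hB hq).weaken (T₁ := 10 * (2 * n) + 9) (by omega)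
    le_rfl (fun _ h => h) fun _ _ h => h
  refine Qnt.seq_tri hs ?_ ?_
  · rintro σ₁ ⟨f1, f2⟩
    refine (tri_growP (hσ.of_frame f1 (by omega) (by rw [f2])) (by rw [f1 3 (by omega), h3])
      k).weaken le_rfl ?_
    rintro τ ⟨g1, g2, -⟩
    exact ⟨f1.trans g1, fun b hb hb' => by rw [g2 b hb hb', f2]⟩
  · rintro σ₁ ⟨f1, f2⟩ hx
    refine (tri_growP (hσ.of_frame f1 (by omega) (by rw [f2])) (by rw [f1 3 (by omega), h3])
      k).weaken le_rfl ?_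
    rintro τ ⟨g1, g2, g3, g4⟩
    refine ⟨⟨f1.trans g1, fun b hb hb' => by rw [g2 b hb hb', f2]⟩, _, hx, ?_⟩
    rw [← f2, grow]
    split_ifs with h
    · exact g3 ⟨_, h⟩ rfl
    · exact g4 (by omega)

/-- One round of a trial: complete the set `W` in array `2` to a vertex cover, keep that cover if it
is the best so far, and enlarge `W` at random. -/
def roundP (k : ℕ) : Prog := .seq (.seq matchP updateP) (.seq sampleP (growP k))

/-- Time bound for `roundP k`. -/
def roundTime (k n : ℕ) : ℕ := matchUpdateTime n + sampleGrowTime k n + 1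

theorem tri_roundP {R : ℕ} (hσ : MainInv G R σ) (k : ℕ) :
    Tri (roundP k) σ (roundTime k n) fun σ' => MainInv G R σ' ∧ Frame 7 σ σ' ∧
      bestCard n σ' ≤ bestCard n σ := by
  refine Tri.seq (tri_match_update hσ.env hσ.cover) ?_
  rintro σ₁ ⟨f1, f2, -, f3, f4, -⟩
  have hσ₁ := hσ.of_frame f1 (by omega) f2 f3
  refine (qnt_sample_grow hσ₁.env hσ₁.reg_three k (q := 0) ∅ (by simp) (by simp)).toTri.weaken
    le_rfl ?_
  rintro σ₂ ⟨g1, g2⟩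
  have e1 : σ₂.arr 1 = σ₁.arr 1 := g2 1 (by omega) (by omega)
  exact ⟨hσ₁.of_frame g1 (by omega) (g2 0 (by omega) (by omega)) (by rw [e1]; exact f3),
    (f1.mono (by omega)).trans g1, by rw [bestCard, e1]; exact f4⟩

/-- The set `W` in array `2` is on its way: `r` rounds of progress have been made, at least
`R - j` of them, and most of `W` lies in `O`. -/
def Promising (G : SimpleGraph (Fin n)) [DecidableRel G.Adj] (k R : ℕ) (O : Finset (Fin n)) (j : ℕ)
    (W : Finset (Fin n)) : Prop :=
  ∃ r, R ≤ r + j ∧ r * G.maxDegree ≤ k * W.card ∧ k * (W \ O).card ≤ W.card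

/-- `β` bounds the size of all the covers that a round can produce from a set that covers almost all
edges and mostly lies in `O`. -/
def GoodBound (G : SimpleGraph (Fin n)) [DecidableRel G.Adj] (k : ℕ) (O : Finset (Fin n))
    (β : ℝ) : Prop :=
  ∀ W C : Finset (Fin n), MatchedExt G W C (fun _ _ => True) → k * (W \ O).card ≤ W.card →
    k * (heavy G k W \ W).card < n → (C.card : ℝ) ≤ β

theorem qnt_roundP {R k j : ℕ} {O : Finset (Fin n)} {β : ℝ} (hσ : MainInv G R σ) (hk : 0 < k)
    (hn : 0 < n) (hO : G.IsVertexCover (O : Set (Fin n))) (hβ : GoodBound G k O β)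
    (hW : Promising G k R O (j + 1) (arrSet n (σ.arr 2))) :
    Qnt (roundP k) σ (roundTime k n) (1 / (4 * k ^ 2))
      (fun σ' => MainInv G R σ' ∧ Frame 7 σ σ')
      fun σ' => (bestCard n σ' : ℝ) ≤ β ∨ Promising G k R O j (arrSet n (σ'.arr 2)) := by
  have hk1 : (1 : ℝ) ≤ k := by exact_mod_cast hk
  refine Tri.seq_qnt (tri_match_update hσ.env hσ.cover) ?_
  rintro σ₁ ⟨f1, f2, f2', f3, -, C, hC, hC'⟩
  have hσ₁ := hσ.of_frame f1 (by omega) f2 f3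
  have hI : ∀ σ₂, (Frame 7 σ₁ σ₂ ∧ ∀ b ≠ 2, b ≠ 4 → σ₂.arr b = σ₁.arr b) →
      MainInv G R σ₂ ∧ Frame 7 σ σ₂ := by
    rintro σ₂ ⟨g1, g2⟩
    exact ⟨hσ₁.of_frame g1 (by omega) (g2 0 (by omega) (by omega))
      (by rw [g2 1 (by omega) (by omega)]; exact f3), (f1.mono (by omega)).trans g1⟩
  obtain ⟨r, hr1, hr2, hr3⟩ := hW
  by_cases hout : k * (heavy G k (arrSet n (σ.arr 2)) \ arrSet n (σ.arr 2)).card < n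
  · -- the cover just found is good
    have hb : (bestCard n σ₁ : ℝ) ≤ β :=
      (Nat.cast_le.2 hC').trans (hβ _ C hC hr3 hout)
    refine Tri.toQnt ((qnt_sample_grow hσ₁.env hσ₁.reg_three k (q := 0) ∅ (by simp)
      (by simp)).toTri.weaken le_rfl fun σ₂ h => ⟨hI σ₂ h, .inl ?_⟩) ?_
    · rw [bestCard, h.2 1 (by omega) (by omega)]
      exact hb
    · rw [div_le_one (by positivity)]
      nlinarith
  · have hd : 2 ^ Nat.clog 2 (2 * n) ≤ 4 * n := by
      have h1 := Nat.pow_pred_clog_lt_self one_lt_two (show 1 < 2 * n by omega)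
      have h2 := Nat.clog_pos one_lt_two (show 1 < 2 * n by omega)
      obtain ⟨e, he⟩ : ∃ e, Nat.clog 2 (2 * n) = e + 1 := ⟨_, (Nat.succ_pred_eq_of_pos h2).symm⟩
      rw [he, Nat.pred_succ] at h1
      rw [he, pow_succ]
      omega
    obtain ⟨B, hB, hB', hgood⟩ := exists_good_choices hk (Nat.le_pow_clog one_lt_two (2 * n)) hd hO
      hr3 (not_lt.1 hout)
    refine (qnt_sample_grow hσ₁.env hσ₁.reg_three k B hB ?_).weaken le_rfl le_rfl hI ?_
    · rw [div_mul_eq_mul_div, one_mul, div_le_iff₀ (by positivity)]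
      have : ((2 ^ Nat.clog 2 (2 * n) : ℕ) : ℝ) ≤ ((4 * k ^ 2 * B.card : ℕ) : ℝ) :=
        Nat.cast_le.2 hB'
      push_cast at this
      linarith
    · rintro σ₂ - ⟨x, hx, hW'⟩
      obtain ⟨g1, g2⟩ := hgood x hx
      rw [f2'] at hW'
      refine .inr ⟨r + 1, by omega, ?_, ?_⟩ <;> rw [hW']
      · rw [Nat.succ_mul]; omega
      · exact g2

/-- A trial: start from the empty set in array `2` and run the rounds. -/
def trialP (k : ℕ) : Prog := .seq (fillP 2 2) (.seq (.add 6 4 2) (down 6 (roundP k)))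

/-- Time bound for `trialP k` with `R` rounds. -/
def trialTime (k n R : ℕ) : ℕ := n * 4 + 3 + (R * (roundTime k n + 3) + 1 + 2) + 1

theorem tri_rounds_body {R t k j : ℕ} (h : MainInv G R σ ∧ σ.reg 5 = t) :
    Tri (roundP k) (σ.setReg 6 j) (roundTime k n) fun σ' =>
      ((MainInv G R σ' ∧ σ'.reg 5 = t) ∧ σ'.reg 6 = j) ∧ bestCard n σ' ≤ bestCard n σ :=
  (tri_roundP (h.1.setReg (by omega)) k).weaken le_rfl fun σ' h' =>
    ⟨⟨⟨h'.1, by rw [h'.2.1 5 (by omega)]; simpa using h.2⟩, by rw [h'.2.1 6 (by omega)]; simp⟩,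
      h'.2.2⟩

theorem tri_trial_start {R k t : ℕ} (h : MainInv G R σ) (ht : σ.reg 5 = t) :
    Tri (fillP 2 2) σ (n * 4 + 3) fun σ' => ∀ x, (MainInv G R (σ'.setReg 6 x) ∧
      (σ'.setReg 6 x).reg 5 = t) ∧ σ'.reg 4 = R ∧ σ'.reg 2 = 0 ∧
      bestCard n (σ'.setReg 6 x) = bestCard n σ ∧
      ∀ O, Promising G k R O R (arrSet n ((σ'.setReg 6 x).arr 2)) := by
  refine (tri_fillP h.env (by omega : 2 < 10)).weaken le_rfl ?_
  rintro σ' ⟨f1, f2, f3⟩ x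
  have e1 : σ'.arr 1 = σ.arr 1 := f2 1 (by omega)
  have hσ' := h.of_frame f1 (by omega) (f2 0 (by omega)) (by rw [e1]; exact h.cover)
  have hW : arrSet n ((σ'.setReg 6 x).arr 2) = ∅ := by
    ext v
    simp [mem_arrSet, f3 v v.2, h.env.reg_two]
  refine ⟨⟨hσ'.setReg (by omega), ?_⟩, hσ'.reg_four, hσ'.env.reg_two, ?_, fun O => ?_⟩
  · simp [f1 5 (by omega), ht]
  · rw [bestCard, bestCard, Mem.setReg_arr, e1]
  · rw [hW]
    exact ⟨0, by omega, by simp, by simp⟩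

theorem tri_trialP {R k t : ℕ} {c : ℝ} (h : MainInv G R σ) (ht : σ.reg 5 = t)
    (hc : (bestCard n σ : ℝ) ≤ c) :
    Tri (trialP k) σ (trialTime k n R) fun σ' => (MainInv G R σ' ∧ σ'.reg 5 = t) ∧
      (bestCard n σ' : ℝ) ≤ c := by
  refine Tri.seq (tri_trial_start (k := k) h ht) fun σ₁ h₁ => Tri.add_seq ?_
  obtain ⟨h1, h2, h3, h4, -⟩ := h₁ (σ₁.reg 4 + σ₁.reg 2)
  refine Tri.down (I := fun _ τ => (MainInv G R τ ∧ τ.reg 5 = t) ∧ (bestCard n τ : ℝ) ≤ c)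
    (fun _ τ hτ => hτ.1.1.env.reg_one) (fun j τ hτ _ => ?_) R _ ⟨h1, by rw [h4]; exact hc⟩ ?_
  · exact (tri_rounds_body hτ.1).weaken le_rfl fun τ' h' =>
      ⟨⟨h'.1.1, (Nat.cast_le.2 h'.2).trans hτ.2⟩, h'.1.2⟩
  · simp [h2, h3]

theorem qnt_trialP {R k t : ℕ} {O : Finset (Fin n)} {β : ℝ} (h : MainInv G R σ)
    (ht : σ.reg 5 = t) (hk : 0 < k) (hn : 0 < n) (hO : G.IsVertexCover (O : Set (Fin n)))
    (hβ : GoodBound G k O β) (hR : k * n < R * G.maxDegree) :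
    Qnt (trialP k) σ (trialTime k n R) ((1 / (4 * k ^ 2)) ^ R)
      (fun σ' => MainInv G R σ' ∧ σ'.reg 5 = t) fun σ' => (bestCard n σ' : ℝ) ≤ β := by
  have hk1 : (1 : ℝ) ≤ k := by exact_mod_cast hk
  refine Tri.seq_qnt (tri_trial_start (k := k) h ht) fun σ₁ h₁ => Qnt.step_seq (fun _ => rfl) ?_
  obtain ⟨h1, h2, h3, h4, h5⟩ := h₁ (σ₁.reg 4 + σ₁.reg 2)
  refine Qnt.down_pow (H := fun j τ => Promising G k R O j (arrSet n (τ.arr 2))) (by positivity)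
    ?_ (fun τ hτ => hτ.1.env.reg_one) (fun j τ hτ _ => ?_) (fun j τ hτ hg _ => ?_)
    (fun j τ hτ hH _ => ?_) (fun τ hτ hH => ?_) R _ h1 (h5 O) ?_
  · rw [div_le_one (by positivity)]
    nlinarith
  · exact (tri_rounds_body hτ).weaken le_rfl fun τ' h' => h'.1
  · exact (tri_rounds_body hτ).weaken le_rfl fun τ' h' =>
      ⟨h'.1, (Nat.cast_le.2 h'.2).trans hg⟩
  · refine (qnt_roundP (hτ.1.setReg (by omega)) hk hn hO hβ hH).weaken le_rfl le_rfl
      (fun τ' h' => ⟨⟨h'.1, ?_⟩, ?_⟩) fun _ _ h => h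
    · rw [h'.2 5 (by omega)]; simpa using hτ.2
    · rw [h'.2 6 (by omega)]; simp
  · -- `R` rounds of progress would make the set larger than `n`
    obtain ⟨r, hr1, hr2, -⟩ := hH
    have hle : (arrSet n (τ.arr 2)).card ≤ n := by
      simpa using Finset.card_le_univ (arrSet n (τ.arr 2))
    have h6 := Nat.mul_le_mul_left k hle
    have h7 := Nat.mul_le_mul_right G.maxDegree hr1
    rw [Nat.add_zero] at h7
    omega
  · simp [h2, h3]

/-- The algorithm; `1 / k` is its precision. -/
def mainP (k : ℕ) : Prog := .seq (initP k (4 * k ^ 2)) (down 5 (trialP k))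

/-- Time bound for `mainP k` if each trial has `R` rounds. -/
def mainTime (k n R : ℕ) : ℕ :=
  n * (n * (4 * n + 17) + 16) + 4 * k + 4 * R + R * (4 * (4 * k ^ 2) + 6) + 27 +
    (n * 2 ^ (4 * k ^ 2 * R) * (trialTime k n R + 3) + 1) + 1

theorem tri_mainP (k : ℕ) {m : ℕ}
    (hm : k * n ≤ m * G.maxDegree) (hm' : m * G.maxDegree < k * n + G.maxDegree) :
    Tri (mainP k) (graphInput G) (mainTime k n (m + 1)) fun σ =>
      G.IsVertexCover (arrSet n (σ.arr 1) : Set (Fin n)) := by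
  refine Tri.seq ((tri_initP k _ hm hm').weaken (by omega) fun _ h => h) ?_
  rintro σ ⟨h1, h3, h4, h5, hc⟩
  have hI : MainInv G (m + 1) σ := ⟨h1, h3, h4, by rw [hc]; simp⟩
  refine (Tri.down (I := fun _ τ => MainInv G (m + 1) τ) (fun _ τ hτ => hτ.env.reg_one)
    (fun j τ hτ _ => ?_) _ σ hI h5).weaken le_rfl fun τ hτ => hτ.cover
  exact (tri_trialP (hτ.setReg (by omega)) (by simp) le_rfl).weaken le_rfl fun τ h => h.1

theorem qnt_mainP {k m : ℕ} {O : Finset (Fin n)} {β : ℝ} (hk : 0 < k) (hn : 0 < n)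
    (hΔ : 0 < G.maxDegree)
    (hm : k * n ≤ m * G.maxDegree) (hm' : m * G.maxDegree < k * n + G.maxDegree)
    (hO : G.IsVertexCover (O : Set (Fin n))) (hβ : GoodBound G k O β) :
    Qnt (mainP k) (graphInput G) (mainTime k n (m + 1))
      (1 - (1 - (1 / (4 * k ^ 2)) ^ (m + 1)) ^ (n * 2 ^ (4 * k ^ 2 * (m + 1)))) (fun _ => True)
      fun σ => (bestCard n σ : ℝ) ≤ β := by
  have hk1 : (1 : ℝ) ≤ k := by exact_mod_cast hk
  refine Tri.seq_qnt ((tri_initP k _ hm hm').weaken (by omega) fun _ h => h) ?_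
  rintro σ ⟨h1, h3, h4, h5, hc⟩
  have hI : MainInv G (m + 1) σ := ⟨h1, h3, h4, by rw [hc]; simp⟩
  refine (Qnt.down_trials (I := MainInv G (m + 1)) ?_ (fun τ hτ => hτ.env.reg_one)
    (fun j τ hτ hg _ => ?_) (fun j τ hτ _ => ?_) _ σ hI h5).weaken le_rfl le_rfl
    (fun _ _ => trivial) fun _ _ h => h
  · refine pow_le_one₀ (by positivity) ?_
    rw [div_le_one (by positivity)]
    nlinarith
  · exact tri_trialP (hτ.setReg (by omega)) (by simp) hg
  · exact qnt_trialP (hτ.setReg (by omega)) (by simp) hk hn hO hβ (by rw [Nat.succ_mul]; omega)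

theorem haltsIn_mainP (k : ℕ) {m : ℕ}
    (hm : k * n ≤ m * G.maxDegree) (hm' : m * G.maxDegree < k * n + G.maxDegree) {T : ℕ}
    (hT : mainTime k n (m + 1) ≤ T) : HaltsIn (mainP k) (graphInput G) T := by
  refine haltsIn_of_hitProb ?_
  exact ((tri_mainP k hm hm').weaken hT fun _ h => h) [] Set.univ 0 1
    fun σ' _ => (hitProb_zero (Set.mem_univ _)).ge

/-- `n * 2 ^ (s * R)` trials with success probability at least `2 ^ (- s * R)` all fail with
probability at most `exp (-n)`. -/
theorem trials_fail_le {k : ℕ} (hk : 0 < k) {n : ℕ} (hn : 0 < n) (R : ℕ) :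
    (1 - (1 / (4 * (k : ℝ) ^ 2)) ^ R) ^ (n * 2 ^ (4 * k ^ 2 * R)) ≤ 1 / (n : ℝ) := by
  have hk1 : (1 : ℝ) ≤ k := by exact_mod_cast hk
  set q : ℝ := 1 / (4 * (k : ℝ) ^ 2) with hq
  have hq0 : 0 < q := by positivity
  have hq1 : q ≤ 1 := by rw [hq, div_le_one (by positivity)]; nlinarith
  have h1 : 1 ≤ q ^ R * 2 ^ (4 * k ^ 2 * R) := by
    rw [pow_mul, ← mul_pow]
    refine one_le_pow₀ ?_
    rw [hq, div_mul_eq_mul_div, one_mul, le_div_iff₀ (by positivity), one_mul]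
    exact_mod_cast (Nat.lt_two_pow_self (n := 4 * k ^ 2)).le
  have hqR : q ^ R ≤ 1 := pow_le_one₀ hq0.le hq1
  calc (1 - q ^ R) ^ (n * 2 ^ (4 * k ^ 2 * R))
      ≤ (Real.exp (-q ^ R)) ^ (n * 2 ^ (4 * k ^ 2 * R)) :=
        pow_le_pow_left₀ (by linarith) (by linarith [Real.add_one_le_exp (-q ^ R)]) _
    _ = Real.exp (-(n * (q ^ R * 2 ^ (4 * k ^ 2 * R)))) := by
        rw [← Real.exp_nat_mul]; congr 1; push_cast; ring
    _ ≤ Real.exp (-n) := by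
        refine Real.exp_le_exp.2 (neg_le_neg ?_)
        exact le_mul_of_one_le_right (by positivity) h1
    _ ≤ 1 / n := by
        rw [Real.exp_neg, ← one_div]
        exact one_div_le_one_div_of_le (by exact_mod_cast hn)
          (by linarith [Real.add_one_le_exp (n : ℝ)])

theorem approximatesVC_mainP {k m : ℕ} {β ρ : ℝ} {O : Finset (Fin n)} (hk : 0 < k) (hn : 0 < n)
    (hΔ : 0 < G.maxDegree)
    (hm : k * n ≤ m * G.maxDegree) (hm' : m * G.maxDegree < k * n + G.maxDegree)
    (hO : G.IsVertexCover (O : Set (Fin n))) (hβ : GoodBound G k O β)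
    (hρ : β = ρ * (G.vertexCoverNum.toNat : ℝ)) :
    (mainP k).ApproximatesVC G ρ (1 - 1 / (n : ℝ)) := by
  refine ⟨mainTime k n (m + 1), haltsIn_mainP k hm hm' le_rfl, fun σ hσ => ?_, ?_⟩
  · refine mem_of_hitProb (S := {σ | G.IsVertexCover (outputSet n σ : Set (Fin n))}) ?_ hσ
    exact tri_mainP k hm hm' [] _ 0 1 fun σ' h => (hitProb_zero h).ge
  · refine le_trans ?_ (hitProb_le_memAfter _ _ _ _)
    have h := qnt_mainP hk hn hΔ hm hm' hO hβ []
      {σ | ((outputSet n σ).card : ℝ) ≤ ρ * (G.vertexCoverNum.toNat : ℝ)} 0 0 1 zero_le_one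
      (fun _ _ => hitProb_nonneg _ _ _) fun σ' _ h => (hitProb_zero (by rw [hρ] at h; exact h)).ge
    have h2 := trials_fail_le hk hn (m + 1)
    refine le_trans ?_ h
    linarith

end Main

/-! ### Running time -/

section RunningTime

theorem mainTime_le (k n : ℕ) {R : ℕ} (hR : 1 ≤ R) :
    mainTime k n R ≤ 400 * (k + 1) ^ 2 * ((n + 1) ^ 4 * 2 ^ ((4 * k ^ 2 + 1) * R)) := by
  set Z := (n + 1) ^ 3 with hZ
  set E := 2 ^ (4 * k ^ 2 * R) with hE
  have hE1 : 1 ≤ E := Nat.one_le_two_pow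
  have eZ : Z = n * n * n + 3 * (n * n) + 3 * n + 1 := by rw [hZ]; ring
  have hkn : k * n ≤ k * Z := Nat.mul_le_mul_left k (by omega)
  have hkZ : k ≤ k * Z := Nat.le_mul_of_pos_right k (by omega)
  have hround : roundTime k n ≤ (150 + 4 * k) * Z := by
    rw [roundTime, matchUpdateTime, sampleGrowTime]
    ring_nf at eZ hkn ⊢
    omega
  have hRZ : Z ≤ Z * R := Nat.le_mul_of_pos_right Z hR
  have htrial : trialTime k n R + 3 ≤ (170 + 4 * k) * (Z * R) := by
    have h := Nat.mul_le_mul_left R (Nat.add_le_add_right hround 3)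
    have h2 : R * 3 ≤ 3 * (Z * R) := by
      have : R ≤ Z * R := Nat.le_mul_of_pos_left R (by omega)
      omega
    rw [trialTime]
    nlinarith
  have hinit : n * (n * (4 * n + 17) + 16) + 4 * k + 4 * R + R * (4 * (4 * k ^ 2) + 6) + 27 ≤
      (80 + 4 * k + 16 * k ^ 2) * (Z * R) := by
    have h1 : n * (n * (4 * n + 17) + 16) ≤ 37 * Z := by
      ring_nf at eZ ⊢; omega
    have h2 : R ≤ Z * R := Nat.le_mul_of_pos_left R (by omega)
    have h3 : k * 1 ≤ k * (Z * R) := Nat.mul_le_mul_left k (by omega)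
    have h4 : k ^ 2 * R ≤ k ^ 2 * (Z * R) := Nat.mul_le_mul_left _ h2
    nlinarith
  have hR2 : R ≤ 2 ^ R := Nat.lt_two_pow_self.le
  have h1 : (Z * R) * 1 ≤ (Z * R) * ((n + 1) * E) :=
    Nat.mul_le_mul_left _ (by nlinarith)
  have h2 : n * E * (trialTime k n R + 3) ≤ (n + 1) * E * ((170 + 4 * k) * (Z * R)) :=
    Nat.mul_le_mul (Nat.mul_le_mul_right E (by omega)) htrial
  calc mainTime k n R ≤ (252 + 8 * k + 16 * k ^ 2) * ((Z * R) * ((n + 1) * E)) := by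
        rw [mainTime, ← hE]
        have : (80 + 4 * k + 16 * k ^ 2) * ((Z * R) * 1)
            ≤ (80 + 4 * k + 16 * k ^ 2) * ((Z * R) * ((n + 1) * E)) := Nat.mul_le_mul_left _ h1
        have h3 : 2 ≤ 2 * ((Z * R) * ((n + 1) * E)) := by omega
        linarith
    _ ≤ (400 * (k + 1) ^ 2) * ((Z * R) * ((n + 1) * E)) :=
        Nat.mul_le_mul_right _ (by ring_nf; omega)
    _ ≤ (400 * (k + 1) ^ 2) * ((Z * 2 ^ R) * ((n + 1) * E)) := by gcongr
    _ = _ := by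
        rw [show (4 * k ^ 2 + 1) * R = 4 * k ^ 2 * R + R by ring, pow_add, ← hE, hZ]
        ring

theorem exists_ceil_div (a : ℕ) {D : ℕ} (hD : 0 < D) : ∃ m, a ≤ m * D ∧ m * D < a + D := by
  refine ⟨(a + D - 1) / D, ?_, ?_⟩
  · have := Nat.lt_div_mul_add (a := a + D - 1) hD
    omega
  · have := Nat.div_mul_le_self (a + D - 1) D
    omega

theorem maxDegree_pos_of_le {n Δ : ℕ} (hn : 0 < n) {c ψ : ℝ} (hc : 0 < c) (hψ : 0 < ψ)
    (h : c * ((n : ℝ) / ψ) ≤ Δ) : 0 < Δ := by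
  have : (0 : ℝ) < n := by exact_mod_cast hn
  have : 0 < c * ((n : ℝ) / ψ) := by positivity
  exact_mod_cast this.trans_le h

/-- The number of rounds is `O(ψ)` if `Δ ≥ c n / ψ`, so that the running time is
`n ^ O(1) * 2 ^ O(ψ)`. -/
theorem exists_mainTime_le (k : ℕ) {c : ℝ} (hc : 0 < c) :
    ∃ A : ℕ, ∀ n Δ m : ℕ, 2 ≤ n → ∀ ψ : ℝ, 0 < ψ → c * ((n : ℝ) / ψ) ≤ Δ →
      m * Δ < k * n + Δ → (mainTime k n (m + 1) : ℝ) ≤ (n : ℝ) ^ A * 2 ^ (A * ψ) := by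
  set s := 4 * k ^ 2 + 1 with hs
  obtain ⟨C, hC⟩ : ∃ C, C = 400 * (k + 1) ^ 2 := ⟨_, rfl⟩
  set A₁ := C + 8 + s * 2 with hA₁
  set A₂ := ⌈s * (k / c)⌉₊ with hA₂
  refine ⟨A₁ + A₂, fun n Δ m hn ψ hψ hΔ hm => ?_⟩
  have hn' : (2 : ℝ) ≤ n := by exact_mod_cast hn
  have hΔ0 : (0 : ℝ) < Δ := by exact_mod_cast maxDegree_pos_of_le (by omega) hc hψ hΔ
  have hR : ((m + 1 : ℕ) : ℝ) ≤ 2 + k / c * ψ := by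
    have h1 : (m : ℝ) * Δ < k * n + Δ := by exact_mod_cast hm
    have h2 : (n : ℝ) ≤ Δ * ψ / c := by
      rw [le_div_iff₀ hc]
      rw [mul_div_assoc', div_le_iff₀ hψ] at hΔ
      linarith
    have h3 : (m : ℝ) * Δ < (k / c * ψ + 1) * Δ := by
      have := mul_le_mul_of_nonneg_left h2 (Nat.cast_nonneg (α := ℝ) k)
      calc (m : ℝ) * Δ < k * n + Δ := h1
        _ ≤ k * (Δ * ψ / c) + Δ := by linarith
        _ = _ := by ring
    have := lt_of_mul_lt_mul_right h3 hΔ0.le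
    push_cast
    linarith
  have h1 : (mainTime k n (m + 1) : ℝ) ≤ C * ((n + 1) ^ 4 * 2 ^ (s * (m + 1))) := by
    rw [hC]
    exact_mod_cast mainTime_le k n (R := m + 1) (by omega)
  have h2 : (C : ℝ) ≤ n ^ C :=
    (by exact_mod_cast Nat.lt_two_pow_self.le : (C : ℝ) ≤ 2 ^ C).trans
      (pow_le_pow_left₀ zero_le_two hn' C)
  have h3 : ((n : ℝ) + 1) ^ 4 ≤ n ^ 8 := by
    rw [show (8 : ℕ) = 2 * 4 from rfl, pow_mul]
    exact pow_le_pow_left₀ (by positivity) (by nlinarith) 4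
  have h4 : (2 : ℝ) ^ (s * (m + 1)) ≤ n ^ (s * 2) * 2 ^ (A₂ * ψ) := by
    calc (2 : ℝ) ^ (s * (m + 1)) = (2 : ℝ) ^ ((s * (m + 1) : ℕ) : ℝ) := (Real.rpow_natCast _ _).symm
      _ ≤ 2 ^ (((s * 2 : ℕ) : ℝ) + A₂ * ψ) := by
          refine Real.rpow_le_rpow_of_exponent_le one_le_two ?_
          have h5 := mul_le_mul_of_nonneg_left hR (Nat.cast_nonneg (α := ℝ) s)
          have h6 := mul_le_mul_of_nonneg_right (Nat.le_ceil ((s : ℝ) * (k / c))) hψ.le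
          push_cast at h5 ⊢
          calc (s : ℝ) * (m + 1) ≤ s * (2 + k / c * ψ) := h5
            _ = s * 2 + s * (k / c) * ψ := by ring
            _ ≤ _ := by linarith
      _ = 2 ^ (s * 2) * 2 ^ (A₂ * ψ) := by
          rw [Real.rpow_add zero_lt_two, Real.rpow_natCast]
      _ ≤ _ := by gcongr
  calc (mainTime k n (m + 1) : ℝ) ≤ C * ((n + 1) ^ 4 * 2 ^ (s * (m + 1))) := h1
    _ ≤ n ^ C * (n ^ 8 * (n ^ (s * 2) * 2 ^ (A₂ * ψ))) := by gcongr
    _ = n ^ A₁ * 2 ^ (A₂ * ψ) := by rw [hA₁, pow_add, pow_add]; ring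
    _ ≤ n ^ (A₁ + A₂) * 2 ^ (((A₁ + A₂ : ℕ) : ℝ) * ψ) := by
        gcongr
        · linarith
        · omega
        · exact one_le_two
        · omega

theorem eventually_one_le_log_log_log :
    ∀ᶠ n : ℕ in Filter.atTop, 1 ≤ Real.log (Real.log (Real.log (n : ℝ))) :=
  (Real.tendsto_log_atTop.comp (Real.tendsto_log_atTop.comp
    (Real.tendsto_log_atTop.comp tendsto_natCast_atTop_atTop))).eventually_ge_atTop 1

end RunningTime

end RandRAM

open RandRAM

theorem theorem2p2 (ε : ℝ) (hε : 0 < ε) :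
    ∃ P : RandRAM.Prog,
      -- approximation ratio
      (∀ (n : ℕ) (G : SimpleGraph (Fin n)) [DecidableRel G.Adj],
        0 < G.maxDegree → (G.maxDegree : ℝ) ≤ (n : ℝ) / 2 →
        P.ApproximatesVC G (2 / (1 + G.avgDegree / (2 * (G.maxDegree : ℝ))) + ε)
          (1 - 1 / (n : ℝ))) ∧
      -- running time
      (∀ c : ℝ, 0 < c → ∃ K N : ℕ, ∀ ψ : ℕ → ℝ, (∀ n, 0 < ψ n) →
        ∀ n : ℕ, N ≤ n → ∀ (G : SimpleGraph (Fin n)) [DecidableRel G.Adj],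
          (G.maxDegree : ℝ) ≤ (n : ℝ) / 2 → c * ((n : ℝ) / ψ n) ≤ (G.maxDegree : ℝ) →
          ∃ T : ℕ, RandRAM.HaltsIn P (RandRAM.graphInput G) T ∧
            (T : ℝ) ≤ (n : ℝ) ^ K *
              (2 : ℝ) ^ ((K : ℝ) * (ψ n * Real.log (Real.log (Real.log (n : ℝ)))))) ∧
      -- the polynomial case
      (∀ (c : ℝ) (ψ : ℕ → ℝ), 0 < c → (∀ n, 0 < ψ n) →
        (ψ =O[Filter.atTop]
          fun n : ℕ => Real.log (n : ℝ) / Real.log (Real.log (Real.log (n : ℝ)))) →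
        ∃ p : Polynomial ℕ, ∀ n : ℕ, 0 < n → ∀ (G : SimpleGraph (Fin n)) [DecidableRel G.Adj],
          (G.maxDegree : ℝ) ≤ (n : ℝ) / 2 → c * ((n : ℝ) / ψ n) ≤ (G.maxDegree : ℝ) →
          RandRAM.HaltsIn P (RandRAM.graphInput G) (p.eval n)) := by
  obtain ⟨k, hk2, hk⟩ : ∃ k : ℕ, 2 ≤ k ∧ 6 ≤ k * ε ^ 2 := by
    refine ⟨2 + ⌈6 / ε ^ 2⌉₊, by omega, ?_⟩
    have h := Nat.le_ceil (6 / ε ^ 2)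
    rw [div_le_iff₀ (by positivity)] at h
    push_cast
    nlinarith [sq_nonneg ε]
  refine ⟨mainP k, fun n G _ hΔ _ => ?_, fun c hc => ?_, fun c ψ hc hψ hO => ?_⟩
  · have hn : 0 < n := by
      rcases Nat.eq_zero_or_pos n with rfl | h
      · simp at hΔ
      · exact h
    obtain ⟨m, hm, hm'⟩ := exists_ceil_div (k * n) hΔ
    obtain ⟨O, hO, hOc⟩ := exists_isVertexCover_card_eq G
    refine approximatesVC_mainP (by omega) hn hΔ hm hm' hO (β := _ * (O.card : ℝ)) ?_
      (by rw [← hOc])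
    intro W C hC hW hout
    have := hC.bound O hO
    exact card_le_ratio hε hk2 hk hΔ hO (by omega) hW hout
  · obtain ⟨A, hA⟩ := exists_mainTime_le k hc
    obtain ⟨N, hN⟩ := Filter.eventually_atTop.1
      (eventually_one_le_log_log_log.and (Filter.eventually_ge_atTop 2))
    refine ⟨A, N, fun ψ hψ n hn G _ _ hΔ => ?_⟩
    obtain ⟨hlog, hn2⟩ := hN n hn
    have hΔ0 := maxDegree_pos_of_le (by omega) hc (hψ n) hΔ
    obtain ⟨m, hm, hm'⟩ := exists_ceil_div (k * n) hΔ0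
    refine ⟨_, haltsIn_mainP k hm hm' le_rfl, (hA n _ m hn2 (ψ n) (hψ n) hΔ hm').trans ?_⟩
    gcongr
    · exact one_le_two
    · exact le_mul_of_one_le_right (hψ n).le hlog
  · obtain ⟨A, hA⟩ := exists_mainTime_le k hc
    obtain ⟨B, hB⟩ := hO.bound
    obtain ⟨N, hN⟩ := Filter.eventually_atTop.1
      ((eventually_one_le_log_log_log.and (Filter.eventually_ge_atTop 2)).and hB)
    -- the finitely many graphs on fewer than `N` vertices are covered by a constant
    set S := ∑ n ∈ Finset.range N, ∑ m ∈ Finset.range (k * n + 1), mainTime k n (m + 1) with hS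
    refine ⟨Polynomial.X ^ (A + A * ⌈B⌉₊) + Polynomial.C S, fun n hn G _ _ hΔ => ?_⟩
    have hΔ0 := maxDegree_pos_of_le hn hc (hψ n) hΔ
    obtain ⟨m, hm, hm'⟩ := exists_ceil_div (k * n) hΔ0
    refine haltsIn_mainP k hm hm' ?_
    simp only [Polynomial.eval_add, Polynomial.eval_pow, Polynomial.eval_X, Polynomial.eval_C]
    rcases lt_or_ge n N with hnN | hnN
    · have hmk : m < k * n + 1 := by
        by_contra hcon
        have := Nat.mul_le_mul_right G.maxDegree (not_lt.1 hcon)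
        have := Nat.le_mul_of_pos_right (k * n) hΔ0
        rw [Nat.succ_mul] at *
        omega
      refine le_trans ?_ (Nat.le_add_left _ _)
      exact (Finset.single_le_sum (f := fun m => mainTime k n (m + 1)) (fun _ _ => Nat.zero_le _)
        (Finset.mem_range.2 hmk)).trans (Finset.single_le_sum
          (f := fun n => ∑ m ∈ Finset.range (k * n + 1), mainTime k n (m + 1))
          (fun _ _ => Nat.zero_le _) (Finset.mem_range.2 hnN))
    · obtain ⟨⟨hlog, hn2⟩, hψB⟩ := hN n hnN
      refine le_trans ?_ (Nat.le_add_right _ _)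
      have hn0 : (0 : ℝ) < n := by exact_mod_cast hn
      have hlogn : 0 ≤ Real.log n := Real.log_nonneg (by exact_mod_cast hn)
      have hψ' : ψ n ≤ ⌈B⌉₊ * Real.log n := by
        rw [Real.norm_of_nonneg (hψ n).le, Real.norm_of_nonneg (by positivity)] at hψB
        refine hψB.trans (mul_le_mul (Nat.le_ceil B) (div_le_self hlogn hlog) (by positivity)
          (by positivity))
      have h2 : (2 : ℝ) ^ (A * ψ n) ≤ (n : ℝ) ^ (A * ⌈B⌉₊) := by
        rw [← Real.rpow_natCast, Real.rpow_def_of_pos zero_lt_two, Real.rpow_def_of_pos hn0]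
        refine Real.exp_le_exp.2 ?_
        have h3 : Real.log 2 ≤ 1 := by linarith [Real.log_two_lt_d9]
        have h4 : 0 ≤ A * ψ n := mul_nonneg (Nat.cast_nonneg A) (hψ n).le
        calc Real.log 2 * (A * ψ n) ≤ 1 * (A * ψ n) := by gcongr
          _ ≤ A * (⌈B⌉₊ * Real.log n) := by rw [one_mul]; gcongr
          _ = _ := by push_cast; ring
      have h5 := hA n _ m hn2 (ψ n) (hψ n) hΔ hm'
      have h6 : (mainTime k n (m + 1) : ℝ) ≤ (n : ℝ) ^ (A + A * ⌈B⌉₊) := by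
        rw [pow_add]
        exact h5.trans (by gcongr)
      exact_mod_cast h6
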